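/- Let $n\ge 3$. Let $\omega_{n-1}$ be the area of the unit sphere $S^{n-1}\subset\mathbb{R}^n$ and $g_0$ its standard metric. Let $\mathrm{RotSym}^\partial_n$ be the class of complete smooth rotationally symmetric $n$-dimensional Riemannian manifolds $(M,g)$ of nonnegative scalar curvature, with connected nonempty boundary that is an outermost and outer-minimizing minimal hypersurface, and whose symmetric spheres have areas tending to infinity along the end. In geodesic coordinates $M=[0,\infty)\times S^{n-1}$ and $g=ds^2+r(s)^2g_0$, where $s$ is the distance from $\partial M$ and $r:[0,\infty)\to(0,\infty)$ is smooth with $r(s)\to\infty$ as $s\to\infty$. The symmetric sphere $\{s\}\times S^{n-1}$ has area $\omega_{n-1}r(s)^{n-1}$ and Hawking mass $\frac{r^{n-2}}{2}\bigl(1-(\frac{dr}{ds})^2\bigr)$, and $m_{\mathrm{ADM}}$ is the limit of the Hawking masses as $s\to\infty$. For $m>0$ let $M_{\mathrm{Sch}}(m)$ be $[(2m)^{1/(n-2)},\infty)\times S^{n-1}$ with the metric $\bigl(1-\frac{2m}{r^{n-2}}\bigr)^{-1}dr^2+r^2g_0$ (extended smoothly to the boundary through the distance to the boundary as coordinate),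 and for $L\ge0$ let $M_{\mathrm{Sch}}(m,L)$, with metric $g_{\mathrm{Sch},L}$, be $M_{\mathrm{Sch}}(m)$ with the cylinder $[-L,0]\times S^{n-1}$ of radius $(2m)^{1/(n-2)}$ glued to its boundary. Let $M\in\mathrm{RotSym}^\partial_n$, and suppose that $$m_{\mathrm{ADM}}=\frac{1+\delta}{2}\left(\frac{|\partial M|}{\omega_{n-1}}\right)^{\frac{n-2}{n-1}}\quad\text{with } 0\le\delta<1.$$ Put $m_0=\frac12\left(\frac{|\partial M|}{\omega_{n-1}}\right)^{\frac{n-2}{n-1}}$, $A_\delta=(1+\sqrt\delta)^{\frac{n-1}{n-2}}|\partial M|$ and $r_\delta=(1+\sqrt\delta)^{\frac1{n-2}}r(0)$, so that $A_\delta=\omega_{n-1}r_\delta^{n-1}$. Embed $M_{\mathrm{Sch}}(m_0)$ and $M$ isometrically in $\mathbb{R}^{n+1}$ as graphs $x^{n+1}=z(|x'|)$ with $z$ nondecreasing, $M_{\mathrm{Sch}}(m_0)$ with its boundary at height $0$, and $M$ at the height for which the two graphs meet at radius $r_\delta$. The depth of $M$ is the number $L$ for which $\partial M$ then lies at height $-L$.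 Then the depth $L$ of $M$ is well defined, $L\ge0$, and there is a rotationally symmetric (that is, commuting with $SO(n)$) bi-Lipschitz map $\varphi$ of $M$ onto $M_{\mathrm{Sch}}(m_0,L)$ that maps every symmetric sphere of area $A\ge A_\delta$ onto a symmetric sphere of area $A$, is differentiable away from the symmetric sphere of area $A_\delta$, and satisfies, for every nonzero tangent vector $v\in TM$, $$h_\delta^{-1}\le\frac{g(v,v)}{g_{\mathrm{Sch},L}(\varphi_*v,\varphi_*v)}\le h_\delta,$$ where $$h_\delta=\max\left\{(1+\sqrt\delta)^{\frac{2}{n-2}},\,(1+\sqrt\delta)(1+\delta),\,(1-\sqrt\delta)^{-1}\right\}.$$ On the sphere of area $A_\delta$, where $\varphi$ need not be differentiable, $\varphi_*v$ is the one-sided directional derivative of $\varphi$ in the direction $v$, which exists for every $v$. -/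

import Mathlib

open Set Filter Topology MeasureTheory
open scoped NNReal ENNReal ContDiff RealInnerProductSpace

noncomputable section

namespace PenroseStability

/-- Euclidean `n`-space, used as a global chart. -/
abbrev E (n : ℕ) : Type := EuclideanSpace ℝ (Fin n)

/-- The underlying manifold with boundary: `[0, ∞) × S^{n-1}`, identified with the closed exterior
of the unit ball by `(s, θ) ↦ (1 + s) θ`. This is a global smooth chart (up to the boundary), in
which tangent vectors are vectors of `E n` and rotations act linearly. -/
def Ext (n : ℕ) : Set (E n) := {x | 1 ≤ ‖x‖}

/-- The symmetric sphere at coordinate `s`. -/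
def symSphere (n : ℕ) (s : ℝ) : Set (E n) := Metric.sphere 0 (1 + s)

/-! ### Riemannian geometry in the global chart -/

/-- A field of bilinear forms on the chart. -/
abbrev MetricField (n : ℕ) : Type := E n → E n → E n → ℝ

/-- The matrix `(g_{ij})` of a metric in the chart. -/
def gramMatrix {n : ℕ} (g : MetricField n) (x : E n) : Matrix (Fin n) (Fin n) ℝ :=
  Matrix.of fun i j => g x (EuclideanSpace.single i 1) (EuclideanSpace.single j 1)

/-- The partial derivative `∂_i f` on `Ext n` (one-sided where necessary at the boundary). -/
def pd {n : ℕ} (i : Fin n) (f : E n → ℝ) (x : E n) : ℝ :=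
  fderivWithin ℝ f (Ext n) x (EuclideanSpace.single i 1)

/-- The Christoffel symbol `Γ^k_{ij}`. -/
def christoffel {n : ℕ} (g : MetricField n) (k i j : Fin n) (x : E n) : ℝ :=
  (1 / 2) * ∑ l, (gramMatrix g x)⁻¹ k l *
    (pd i (fun y => gramMatrix g y j l) x + pd j (fun y => gramMatrix g y i l) x
      - pd l (fun y => gramMatrix g y i j) x)

/-- The Ricci tensor
`R_{ij} = ∂_k Γ^k_{ij} - ∂_j Γ^k_{ik} + Γ^k_{kl} Γ^l_{ij} - Γ^k_{jl} Γ^l_{ik}`. -/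
def ricci {n : ℕ} (g : MetricField n) (i j : Fin n) (x : E n) : ℝ :=
  (∑ k, (pd k (christoffel g k i j) x - pd j (christoffel g k i k) x))
    + ∑ k, ∑ l, (christoffel g k k l x * christoffel g l i j x
      - christoffel g k j l x * christoffel g l i k x)

/-- The scalar curvature `g^{ij} R_{ij}`. -/
def scalarCurvature {n : ℕ} (g : MetricField n) (x : E n) : ℝ :=
  ∑ i, ∑ j, (gramMatrix g x)⁻¹ i j * ricci g i j x

/-- The divergence `∂_i X^i + Γ^i_{ij} X^j` of a vector field. -/
def divergence {n : ℕ} (g : MetricField n) (X : E n → E n) (x : E n) : ℝ :=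
  (∑ i, pd i (fun y => X y i) x) + ∑ i, ∑ j, christoffel g i i j x * X x j

/-- The Riemannian distance on `Ext n`: the infimum of the lengths of Lipschitz curves. -/
def riemDist {n : ℕ} (g : MetricField n) (x y : E n) : ℝ≥0∞ :=
  ⨅ γ : {γ : ℝ → E n // (∃ K : ℝ≥0, LipschitzOnWith K γ (Icc 0 1)) ∧
      MapsTo γ (Icc 0 1) (Ext n) ∧ γ 0 = x ∧ γ 1 = y},
    ∫⁻ t in Icc (0 : ℝ) 1,
      ENNReal.ofReal (Real.sqrt (g (γ.1 t) (deriv γ.1 t) (deriv γ.1 t)))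

/-! ### Rotationally symmetric manifolds -/

/-- The metric `ds² + r(s)² g₀` on `[0, ∞) × S^{n-1}`, written in the chart: at `x = (1 + s) θ` a
vector `v` has radial part `⟪x, v⟫ / ‖x‖` and spherical part of squared `g₀`-length
`(‖v‖² - ⟪x, v⟫² / ‖x‖²) / ‖x‖²`. -/
def warpedMetric {n : ℕ} (r : ℝ → ℝ) : MetricField n := fun x v w =>
  ⟪x, v⟫ * ⟪x, w⟫ / ‖x‖ ^ 2
    + (r (‖x‖ - 1) / ‖x‖) ^ 2 * (⟪v, w⟫ - ⟪x, v⟫ * ⟪x, w⟫ / ‖x‖ ^ 2)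

/-- The area `ω_{n-1}` of the unit sphere in Euclidean `n`-space. -/
def unitSphereArea (n : ℕ) : ℝ := ((volume : Measure (E n)).toSphere).real univ

/-- The area of the symmetric sphere at `s`, a round sphere of radius `r(s)`. -/
def sphereArea (n : ℕ) (r : ℝ → ℝ) (s : ℝ) : ℝ := unitSphereArea n * r s ^ (n - 1)

/-- The mean curvature, at `x`, of the symmetric sphere through `x`: the divergence of the outward
unit normal field `∂_s`, which in the chart is `x / ‖x‖`. -/
def meanCurvature {n : ℕ} (r : ℝ → ℝ) (x : E n) : ℝ :=
  divergence (warpedMetric r) (fun y => ‖y‖⁻¹ • y) x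

/-- The symmetric sphere at `s` is a minimal hypersurface. -/
def IsMinimalSphere (n : ℕ) (r : ℝ → ℝ) (s : ℝ) : Prop :=
  ∀ x ∈ symSphere n s, meanCurvature r x = 0

/-- The manifold `([0, ∞) × S^{n-1}, ds² + r(s)² g₀)` (which is complete, with connected nonempty
boundary `s = 0`) belongs to the class `RotSym^∂_n`. The two minimality conditions on the boundary
are only required against the symmetric spheres, which is implied by the corresponding
conditions against all hypersurfaces. -/
structure RotSym (n : ℕ) (r : ℝ → ℝ) : Prop where
  smooth : ContDiffOn ℝ ∞ r (Ici 0)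
  pos : ∀ s, 0 ≤ s → 0 < r s
  scalarCurvature_nonneg : ∀ x ∈ Ext n, 0 ≤ scalarCurvature (warpedMetric r) x
  boundary_minimal : IsMinimalSphere n r 0
  outermost : ∀ s, 0 < s → ¬ IsMinimalSphere n r s
  outerMinimizing : ∀ s, 0 ≤ s → sphereArea n r 0 ≤ sphereArea n r s
  /-- The end is not asymptotic to a cylinder: the symmetric spheres exhaust all large radii. -/
  tendsto_radius : Tendsto r atTop atTop

/-- The Hawking mass `(r^{n-2} / 2) (1 - (dr/ds)²)` of the symmetric sphere at `s`. -/
def hawkingMass (n : ℕ) (r : ℝ → ℝ) (s : ℝ) : ℝ :=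
  r s ^ (n - 2) / 2 * (1 - (derivWithin r (Ici 0) s) ^ 2)

/-- The ADM mass, the limit of the Hawking masses of the symmetric spheres, equals `m`. -/
def HasADMMass (n : ℕ) (r : ℝ → ℝ) (m : ℝ) : Prop :=
  Tendsto (hawkingMass n r) atTop (𝓝 m)

/-- `m₀ = (1/2) (|∂M| / ω_{n-1})^{(n-2)/(n-1)}`. -/
def boundaryMass (n : ℕ) (r : ℝ → ℝ) : ℝ :=
  1 / 2 * (sphereArea n r 0 / unitSphereArea n) ^ (((n : ℝ) - 2) / ((n : ℝ) - 1))

/-- `A_δ = (1 + √δ)^{(n-1)/(n-2)} |∂M|`. -/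
def areaDelta (n : ℕ) (r : ℝ → ℝ) (δ : ℝ) : ℝ :=
  (1 + Real.sqrt δ) ^ (((n : ℝ) - 1) / ((n : ℝ) - 2)) * sphereArea n r 0

/-- `r_δ = (1 + √δ)^{1/(n-2)} r(0)`. -/
def radiusDelta (n : ℕ) (r : ℝ → ℝ) (δ : ℝ) : ℝ :=
  (1 + Real.sqrt δ) ^ (1 / ((n : ℝ) - 2)) * r 0

/-! ### Schwarzschild spaces -/

/-- The radius `(2m)^{1/(n-2)}` of the horizon. -/
def horizonRadius (n : ℕ) (m : ℝ) : ℝ := (2 * m) ^ (1 / ((n : ℝ) - 2))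

/-- The distance from the horizon to the sphere of radius `ρ` in the Schwarzschild metric
`(1 - 2m / r^{n-2})⁻¹ dr² + r² g₀`. -/
def schDistance (n : ℕ) (m ρ : ℝ) : ℝ :=
  ∫ t in (horizonRadius n m)..ρ, (Real.sqrt (1 - 2 * m / t ^ (n - 2)))⁻¹

/-- The radius of the symmetric sphere at distance `s ≥ 0` from the horizon, the inverse function
of `schDistance`; thus the Schwarzschild metric is `ds² + schRadius(s)² g₀`. -/
def schRadius (n : ℕ) (m : ℝ) : ℝ → ℝ :=
  Function.invFunOn (schDistance n m) (Ici (horizonRadius n m))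

/-- The radius function, in terms of the distance `s ≥ 0` from the boundary, of the appended
Schwarzschild space `M_Sch(m, L)`: a cylinder of length `L` and radius `(2m)^{1/(n-2)}`, followed
by `M_Sch(m)`. -/
def appendedSchRadius (n : ℕ) (m L s : ℝ) : ℝ :=
  if s ≤ L then horizonRadius n m else schRadius n m (s - L)

/-! ### Depth -/

/-- The height, above its boundary, of the symmetric sphere at `s` when `ds² + r(s)² g₀` is
isometrically embedded in `ℝ^{n+1}` as `(s, θ) ↦ (r(s) θ, z(s))` with `z` nondecreasing,
that is, `(dr/ds)² + (dz/ds)² = 1`. -/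
def graphHeight (r : ℝ → ℝ) (s : ℝ) : ℝ :=
  ∫ u in (0 : ℝ)..s, Real.sqrt (1 - (derivWithin r (Ici 0) u) ^ 2)

/-- `L` is the depth: when `M_Sch(m₀)` is embedded with its boundary at height `0` and `M` with its
boundary at height `-L`, the two embedded hypersurfaces meet at radius `r_δ`. -/
def IsDepth (n : ℕ) (r : ℝ → ℝ) (δ L : ℝ) : Prop :=
  ∃ s σ : ℝ, 0 ≤ s ∧ 0 ≤ σ ∧ r s = radiusDelta n r δ ∧
    schRadius n (boundaryMass n r) σ = radiusDelta n r δ ∧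
    -L + graphHeight r s = graphHeight (schRadius n (boundaryMass n r)) σ

/-! ### Maps -/

/-- `φ` commutes with the action of `SO(n)`. -/
def IsRotEquivariant {n : ℕ} (φ : E n → E n) : Prop :=
  ∀ Q ∈ Matrix.specialOrthogonalGroup (Fin n) ℝ, ∀ x ∈ Ext n,
    φ (Matrix.toEuclideanLin Q x) = Matrix.toEuclideanLin Q (φ x)

/-- `φ` is a bi-Lipschitz map of `(Ext n, g)` onto `(Ext n, g')`. -/
def IsBiLipschitz {n : ℕ} (g g' : MetricField n) (φ : E n → E n) : Prop :=
  BijOn φ (Ext n) (Ext n) ∧ ∃ K : ℝ≥0, ∀ x ∈ Ext n, ∀ y ∈ Ext n,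
    riemDist g' (φ x) (φ y) ≤ K * riemDist g x y ∧
    riemDist g x y ≤ K * riemDist g' (φ x) (φ y)

/-- `w = φ_* v`, where `φ_* v` is the derivative of `φ` at `x` in the direction `v` from the side
into which `v` points; for outward vectors at the boundary it is `-φ_*(-v)`. Where `φ` is
differentiable this is the value at `v` of the differential of `φ`. -/
def IsPushforward {n : ℕ} (φ : E n → E n) (x v w : E n) : Prop :=
  ((1 < ‖x‖ ∨ 0 ≤ ⟪x, v⟫) ∧ HasDerivWithinAt (fun t : ℝ => φ (x + t • v)) w (Ici 0) 0) ∨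
  (‖x‖ = 1 ∧ ⟪x, v⟫ < 0 ∧ HasDerivWithinAt (fun t : ℝ => φ (x + t • v)) w (Iic 0) 0)

/-- `h_δ = max {(1+√δ)^{2/(n-2)}, (1+√δ)(1+δ), (1-√δ)⁻¹}`. -/
def hDelta (n : ℕ) (δ : ℝ) : ℝ :=
  max (max ((1 + Real.sqrt δ) ^ (2 / ((n : ℝ) - 2))) ((1 + Real.sqrt δ) * (1 + δ)))
    (1 - Real.sqrt δ)⁻¹

end PenroseStability

end

noncomputable section

namespace PenroseStability

section

variable {n : ℕ}

/-! ### Partial derivatives of radial functions -/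

/-! Write `V = 1 - 2 m₀ / r^{n-2}`, the squared radial speed of Schwarzschild at radius `r`. The
curvature computation in the chart gives mean curvature `(n-1) r'/r` for a symmetric sphere, and
shows that the derivative of the Hawking mass is a positive multiple of `r'` times the scalar
curvature. An outermost boundary therefore forces `r' > 0`, the Hawking mass is monotone, and since
it runs from `m₀` to `(1+δ) m₀`, one has `2m₀/r^{n-2} ≤ 1 - r'² ≤ (1+δ) 2m₀/r^{n-2}` everywhere
(`RotSym.radiusProfile`).

The map keeps the point of the sphere and sends `s` to `ψ(s)`, so only the radial stretch `ψ'` and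
the ratio of the radii matter. Let `s₀` be the parameter where `r = r_δ`.

Outside `s₀` spheres are matched by area: `ψ(s)` is `L` plus the Schwarzschild distance of radius
`r(s)`. Then `ψ' = r'/√V ≤ 1`, and the radius `r_δ` is exactly the threshold beyond which the mass
bounds give `ψ'² ≥ 1 - √δ` (`mul_schPotential_le_sq`).

Inside, `ψ(s) = c s`, with `c` the ratio of the lengths of the two inner regions. All radii there
lie in `[r(0), r_δ]`, which costs `(1+√δ)^{2/(n-2)}` on the spheres. The graph slopes with respect
to arc length lie between `(1+√δ)^{-1/2}` and `1`, so lengths and heights agree up to that factor;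
as the depth makes the two graphs meet at `r_δ`, the heights match and `c²` lies between `(1+√δ)⁻¹`
and `1+√δ` (`exists_stretch`). The depth is nonnegative because, radius by radius, `M` climbs at
least as fast as Schwarzschild (`height_comparison`).

The bi-Lipschitz property follows from these bounds on increments by pushing curves forward
(`riemDist_radialMap_le`), and the bound on the metrics from one-sided derivatives of `ψ`
(`radialMap_pushforward_ratio`). -/

theorem hasFDerivAt_norm {F : Type*} [NormedAddCommGroup F] [InnerProductSpace ℝ F] {x : F}
    (hx : x ≠ 0) : HasFDerivAt (fun y : F => ‖y‖) (‖x‖⁻¹ • innerSL ℝ x) x := by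
  have h0 : ‖x‖ ≠ 0 := norm_ne_zero_iff.mpr hx
  have h := (hasStrictFDerivAt_norm_sq x).hasFDerivAt.sqrt (pow_ne_zero 2 h0)
  simp only [Real.sqrt_sq (norm_nonneg _)] at h
  convert h using 1
  ext v
  simp
  field_simp

theorem Ext.norm_pos {x : E n} (hx : x ∈ Ext n) : 0 < ‖x‖ := lt_of_lt_of_le one_pos hx

/-- The exterior of the ball is not convex, but it contains the half-space beyond the tangent
hyperplane at `x` to the sphere through `x`, which is convex with nonempty interior. Hence `pd` is
determined at boundary points too. -/
theorem uniqueDiffWithinAt_Ext {x : E n} (hx : x ∈ Ext n) : UniqueDiffWithinAt ℝ (Ext n) x := by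
  have hx0 := Ext.norm_pos hx
  have hsub : {y : E n | ‖x‖ ^ 2 ≤ ⟪x, y⟫} ⊆ Ext n := by
    intro y hy
    have h1 : ‖x‖ * ‖x‖ ≤ ‖x‖ * ‖y‖ := by
      rw [← sq]
      exact le_trans hy (real_inner_le_norm x y)
    exact le_trans hx (le_of_mul_le_mul_left h1 hx0)
  refine UniqueDiffWithinAt.mono (uniqueDiffWithinAt_convex ?_ ?_ (subset_closure ?_)) hsub
  · exact convex_halfSpace_ge (innerSL ℝ x).isLinear _
  · refine ⟨(2 : ℝ) • x, mem_interior.mpr ⟨{y : E n | ‖x‖ ^ 2 < ⟪x, y⟫}, ?_, ?_, ?_⟩⟩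
    · intro y hy
      exact le_of_lt (show ‖x‖ ^ 2 < ⟪x, y⟫ from hy)
    · exact isOpen_lt continuous_const (innerSL ℝ x).continuous
    · simp only [Set.mem_ofPred_eq, inner_smul_right, real_inner_self_eq_norm_sq]
      nlinarith [sq_pos_of_pos hx0]
  · simp

/-- `f` is differentiable at `x` within `Ext n`, with partial derivatives `D i`. -/
def HasPartials (f : E n → ℝ) (D : Fin n → ℝ) (x : E n) : Prop :=
  DifferentiableWithinAt ℝ f (Ext n) x ∧ ∀ i, pd i f x = D i

namespace HasPartials

variable {f g : E n → ℝ} {D D' : Fin n → ℝ} {x : E n}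

theorem of_hasFDerivWithinAt {f' : E n →L[ℝ] ℝ} (hx : x ∈ Ext n)
    (h : HasFDerivWithinAt f f' (Ext n) x) :
    HasPartials f (fun i => f' (EuclideanSpace.single i 1)) x :=
  ⟨h.differentiableWithinAt, fun i => by rw [pd, h.fderivWithin (uniqueDiffWithinAt_Ext hx)]⟩

theorem const (c : ℝ) : HasPartials (fun _ => c) (fun _ => 0) x :=
  ⟨differentiableWithinAt_const c, fun i => by simp [pd]⟩

theorem coord (hx : x ∈ Ext n) (j : Fin n) :
    HasPartials (fun y : E n => y j) (fun i => if j = i then 1 else 0) x := by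
  have h := of_hasFDerivWithinAt hx
    (EuclideanSpace.proj j : E n →L[ℝ] ℝ).hasFDerivAt.hasFDerivWithinAt
  refine ⟨h.1, fun i => (h.2 i).trans ?_⟩
  simp

theorem add (hx : x ∈ Ext n) (hf : HasPartials f D x) (hg : HasPartials g D' x) :
    HasPartials (fun y => f y + g y) (fun i => D i + D' i) x :=
  ⟨hf.1.add hg.1, fun i => by
    simp only [← hf.2, ← hg.2]
    rw [pd, fderivWithin_fun_add (uniqueDiffWithinAt_Ext hx) hf.1 hg.1]; rfl⟩

theorem mul (hx : x ∈ Ext n) (hf : HasPartials f D x) (hg : HasPartials g D' x) :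
    HasPartials (fun y => f y * g y) (fun i => f x * D' i + g x * D i) x :=
  ⟨hf.1.mul hg.1, fun i => by
    simp only [← hf.2, ← hg.2]
    rw [pd, fderivWithin_fun_mul (uniqueDiffWithinAt_Ext hx) hf.1 hg.1]; rfl⟩

theorem radial (hx : x ∈ Ext n) {F : ℝ → ℝ} {F' : ℝ} (hF : HasDerivWithinAt F F' (Ici 1) ‖x‖) :
    HasPartials (fun y => F ‖y‖) (fun i => F' / ‖x‖ * x i) x := by
  have h0 := Ext.norm_pos hx
  have h := of_hasFDerivWithinAt hx (HasDerivWithinAt.comp_hasFDerivWithinAt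
    (f := fun y : E n => ‖y‖) (s := Ext n) x hF
    (hasFDerivAt_norm (norm_pos_iff.mp h0)).hasFDerivWithinAt (fun y hy => hy))
  refine ⟨h.1, fun i => (h.2 i).trans ?_⟩
  simp [EuclideanSpace.inner_single_right]
  ring

theorem congr (hx : x ∈ Ext n) (hf : HasPartials f D x) (hfg : EqOn g f (Ext n)) :
    HasPartials g D x :=
  ⟨hf.1.congr hfg (hfg hx), fun i => by rw [← hf.2, pd, pd, fderivWithin_congr hfg (hfg hx)]⟩

theorem congr_partials (hf : HasPartials f D x) (h : ∀ i, D i = D' i) : HasPartials f D' x :=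
  ⟨hf.1, fun i => (hf.2 i).trans (h i)⟩

/-- At interior points the function only matters nearby. -/
theorem congr_interior (hx : 1 < ‖x‖) (hf : HasPartials f D x)
    (hfg : ∀ y : E n, 1 < ‖y‖ → g y = f y) : HasPartials g D x := by
  have hev : g =ᶠ[𝓝[Ext n] x] f :=
    Filter.Eventually.filter_mono nhdsWithin_le_nhds
      ((continuous_norm.continuousAt.eventually (lt_mem_nhds hx)).mono hfg)
  exact ⟨hf.1.congr_of_eventuallyEq hev (hfg x hx),
    fun i => by rw [← hf.2, pd, pd, hev.fderivWithin_eq (hfg x hx)]⟩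

end HasPartials

/-! ### Kronecker sums -/

theorem sum_sq_coord (x : E n) : ∑ i, x i * x i = ‖x‖ ^ 2 := by
  rw [EuclideanSpace.norm_sq_eq]
  simp [sq]

/-! ### Christoffel symbols of a rotationally symmetric metric -/

/-- The inverse of the matrix `a δ_{ij} + b x_i x_j`. -/
theorem inv_radial_matrix (x : E n) {a b c : ℝ} (ha : a ≠ 0)
    (hc : b / a + c * (a + b * ‖x‖ ^ 2) = 0) :
    (Matrix.of fun i j : Fin n => a * (if i = j then 1 else 0) + b * (x i * x j))⁻¹
      = Matrix.of fun i j => 1 / a * (if i = j then 1 else 0) + c * (x i * x j) := by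
  -- `hc` is the Sherman–Morrison relation for `c`, with the denominators kept out of it.
  refine Matrix.inv_eq_right_inv ?_
  ext i j
  have hs : ∑ k, x i * x k * (x k * x j) = x i * x j * ‖x‖ ^ 2 := by
    rw [← sum_sq_coord, Finset.mul_sum]
    exact Finset.sum_congr rfl fun k _ => by ring
  -- Each Kronecker delta is moved to the front of its product so that the sum over it collapses;
  -- what is left over is a multiple of `∑ x_k x_k`. All the steps named `expand` have this purpose.
  have expand : ∀ k : Fin n, (a * (if i = k then 1 else 0) + b * (x i * x k)) *
      (1 / a * (if k = j then 1 else 0) + c * (x k * x j)) =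
      (if i = k then (1 : ℝ) else 0) * (a * (1 / a * (if k = j then 1 else 0) + c * (x k * x j)))
      + (if k = j then (1 : ℝ) else 0) * (b * (x i * x k) * (1 / a))
      + b * c * (x i * x k * (x k * x j)) := fun k => by ring
  simp only [Matrix.mul_apply, Matrix.of_apply, expand, Finset.sum_add_distrib, ← Finset.mul_sum,
    hs, Matrix.one_apply]
  simp only [ite_mul, one_mul, zero_mul, Finset.sum_ite_eq, Finset.sum_ite_eq', Finset.mem_univ,
    if_true]
  have h1 : a * (1 / a) = 1 := mul_one_div_cancel ha
  have h2 : b * (1 / a) + a * c + b * c * ‖x‖ ^ 2 = 0 := by rw [← hc]; ring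
  split_ifs
  · linear_combination h1 + (x i * x j) * h2
  · linear_combination (x i * x j) * h2

/-- Christoffel symbols of the metric `A(ρ) δ_{ij} + B(ρ) x_i x_j`, `ρ = ‖x‖`. -/
theorem christoffel_of_radial {g : MetricField n} {A B : ℝ → ℝ} {A' B' c : ℝ} {x : E n}
    (hx : x ∈ Ext n)
    (hg : ∀ y ∈ Ext n, ∀ i j, gramMatrix g y i j
      = A ‖y‖ * (if i = j then 1 else 0) + B ‖y‖ * (y i * y j))
    (hA : HasDerivWithinAt A A' (Ici 1) ‖x‖) (hB : HasDerivWithinAt B B' (Ici 1) ‖x‖)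
    (hA0 : A ‖x‖ ≠ 0) (hc : B ‖x‖ / A ‖x‖ + c * (A ‖x‖ + B ‖x‖ * ‖x‖ ^ 2) = 0)
    (k i j : Fin n) :
    christoffel g k i j x = A' / ‖x‖ / (2 * A ‖x‖) *
        (x i * (if j = k then 1 else 0) + x j * (if i = k then 1 else 0))
      + (B ‖x‖ - A' / ‖x‖ / 2) * (1 / A ‖x‖ + c * ‖x‖ ^ 2) * (if i = j then 1 else 0) * x k
      + (B' / ‖x‖ / 2 * (1 / A ‖x‖ + c * ‖x‖ ^ 2) + c * (A' / ‖x‖)) * (x i * x j * x k) := by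
  have hpd : ∀ a b l, pd l (fun y => gramMatrix g y a b) x
      = A' / ‖x‖ * x l * (if a = b then 1 else 0) + B' / ‖x‖ * x l * (x a * x b)
        + B ‖x‖ * ((if a = l then 1 else 0) * x b + x a * (if b = l then 1 else 0)) := by
    intro a b l
    have h := (((HasPartials.radial hx hA).mul hx
        (HasPartials.const (if a = b then 1 else 0))).add hx
      ((HasPartials.radial hx hB).mul hx
        ((HasPartials.coord hx a).mul hx (HasPartials.coord hx b)))).congr hx
        (g := fun y => gramMatrix g y a b) (fun y hy => hg y hy a b)
    rw [h.2 l]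
    ring
  have hG : gramMatrix g x = Matrix.of fun i j : Fin n =>
      A ‖x‖ * (if i = j then 1 else 0) + B ‖x‖ * (x i * x j) := by
    ext i j
    exact hg x hx i j
  have hinv := inv_radial_matrix x hA0 hc
  rw [← hG] at hinv
  rw [christoffel, hinv]
  simp only [hpd, Matrix.of_apply]
  set a := A ‖x‖
  set b := B ‖x‖
  set α := A' / ‖x‖
  set β := B' / ‖x‖
  have expand : ∀ l : Fin n, (1 / a * (if k = l then 1 else 0) + c * (x k * x l)) *
      (α * x i * (if j = l then 1 else 0) + β * x i * (x j * x l)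
        + b * ((if j = i then 1 else 0) * x l + x j * (if l = i then 1 else 0))
        + (α * x j * (if i = l then 1 else 0) + β * x j * (x i * x l)
        + b * ((if i = j then 1 else 0) * x l + x i * (if l = j then 1 else 0)))
        - (α * x l * (if i = j then 1 else 0) + β * x l * (x i * x j)
        + b * ((if i = l then 1 else 0) * x j + x i * (if j = l then 1 else 0)))) =
      (if k = l then (1 : ℝ) else 0) * (1 / a * (α * x i * (if j = l then 1 else 0)
        + α * x j * (if i = l then 1 else 0) - α * x l * (if i = j then 1 else 0)
        + β * x l * (x i * x j) + 2 * b * (if i = j then 1 else 0) * x l))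
      + (if j = l then (1 : ℝ) else 0) * (c * (x k * x l) * (α * x i))
      + (if i = l then (1 : ℝ) else 0) * (c * (x k * x l) * (α * x j))
      + (c * x k * (- α * (if i = j then 1 else 0) + β * (x i * x j)
        + 2 * b * (if i = j then 1 else 0))) * (x l * x l) := by
    intro l
    simp only [eq_comm (a := j) (b := i), eq_comm (a := l)]
    ring
  simp only [expand, Finset.sum_add_distrib, ← Finset.mul_sum, sum_sq_coord]
  simp only [ite_mul, one_mul, zero_mul, Finset.sum_ite_eq, Finset.mem_univ, if_true]
  field_simp
  ring

end

section

variable {n : ℕ}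

/-! ### Ricci curvature of radial connections -/

/-- The symbols `P (x_i δ_{jk} + x_j δ_{ik}) + Q δ_{ij} x_k + R x_i x_j x_k`. -/
def radialSymbol (P Q R : ℝ) (x : E n) (k i j : Fin n) : ℝ :=
  P * (x i * (if j = k then 1 else 0) + x j * (if i = k then 1 else 0))
    + Q * (if i = j then 1 else 0) * x k + R * (x i * x j * x k)

variable (P Q R : ℝ) (x : E n)

theorem sum_radialSymbol_mul (k j : Fin n) (F : Fin n → ℝ) :
    ∑ l, radialSymbol P Q R x k j l * F l
      = P * (x j * F k + (if j = k then 1 else 0) * ∑ l, x l * F l) + Q * x k * F j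
        + R * (x j * x k) * ∑ l, x l * F l := by
  have expand : ∀ l : Fin n, radialSymbol P Q R x k j l * F l
      = (if l = k then (1 : ℝ) else 0) * (P * x j * F l)
        + (if j = l then (1 : ℝ) else 0) * (Q * x k * F l)
        + (P * (if j = k then 1 else 0) + R * (x j * x k)) * (x l * F l) := by
    intro l
    rw [radialSymbol]
    ring
  simp only [expand, Finset.sum_add_distrib, ← Finset.mul_sum]
  simp only [ite_mul, one_mul, zero_mul, Finset.sum_ite_eq, Finset.sum_ite_eq', Finset.mem_univ,
    if_true]
  split_ifs <;> ring

theorem sum_coord_mul_radialSymbol (i j : Fin n) :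
    ∑ l, x l * radialSymbol P Q R x l i j
      = (2 * P + R * ‖x‖ ^ 2) * (x i * x j) + Q * ‖x‖ ^ 2 * (if i = j then 1 else 0) := by
  have expand : ∀ l : Fin n, x l * radialSymbol P Q R x l i j
      = (if j = l then (1 : ℝ) else 0) * (P * x i * x l)
        + (if i = l then (1 : ℝ) else 0) * (P * x j * x l)
        + (Q * (if i = j then 1 else 0) + R * (x i * x j)) * (x l * x l) := by
    intro l
    rw [radialSymbol]
    ring
  simp only [expand, Finset.sum_add_distrib, ← Finset.mul_sum, sum_sq_coord]
  simp only [ite_mul, one_mul, zero_mul, Finset.sum_ite_eq, Finset.mem_univ, if_true]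
  ring

theorem sum_coord_mul_radialSymbol' (j i : Fin n) :
    ∑ l, x l * radialSymbol P Q R x j i l
      = (P + Q + R * ‖x‖ ^ 2) * (x i * x j) + P * ‖x‖ ^ 2 * (if i = j then 1 else 0) := by
  simp only [mul_comm (x _) (radialSymbol _ _ _ _ _ _ _), sum_radialSymbol_mul, sum_sq_coord]
  ring

theorem radialSymbol_comm (k i j : Fin n) :
    radialSymbol P Q R x k i j = radialSymbol P Q R x k j i := by
  simp only [radialSymbol, eq_comm (a := i) (b := j)]
  ring

theorem sum_radialSymbol_trace (i : Fin n) :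
    ∑ k, radialSymbol P Q R x k i k = ((n + 1) * P + Q + R * ‖x‖ ^ 2) * x i := by
  have expand : ∀ k : Fin n, radialSymbol P Q R x k i k
      = P * x i + (if i = k then (1 : ℝ) else 0) * (P * x k + Q * x k)
        + R * x i * (x k * x k) := by
    intro k
    simp only [radialSymbol, if_true]
    ring
  simp only [expand, Finset.sum_add_distrib, ← Finset.mul_sum, sum_sq_coord]
  simp only [ite_mul, one_mul, zero_mul, Finset.sum_ite_eq, Finset.mem_univ, if_true,
    Finset.sum_const, Finset.card_univ, Fintype.card_fin, nsmul_eq_mul]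
  ring

theorem sum_radialSymbol_mul_radialSymbol (i j : Fin n) :
    ∑ k, ∑ l, radialSymbol P Q R x k j l * radialSymbol P Q R x l i k
      = ((n + 3) * P ^ 2 + 2 * P * Q + 4 * P * R * ‖x‖ ^ 2 + Q ^ 2 + 2 * Q * R * ‖x‖ ^ 2
          + R ^ 2 * ‖x‖ ^ 4) * (x i * x j)
        + 2 * P * Q * ‖x‖ ^ 2 * (if i = j then 1 else 0) := by
  simp only [sum_radialSymbol_mul, sum_coord_mul_radialSymbol]
  have expand : ∀ k : Fin n, P * (x j * radialSymbol P Q R x k i k + (if j = k then 1 else 0) *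
        ((2 * P + R * ‖x‖ ^ 2) * (x i * x k) + Q * ‖x‖ ^ 2 * (if i = k then 1 else 0)))
      + Q * x k * radialSymbol P Q R x j i k
      + R * (x j * x k) * ((2 * P + R * ‖x‖ ^ 2) * (x i * x k)
        + Q * ‖x‖ ^ 2 * (if i = k then 1 else 0))
      = P * x j * radialSymbol P Q R x k i k
        + (if j = k then (1 : ℝ) else 0) * (P * ((2 * P + R * ‖x‖ ^ 2) * (x i * x k)
          + Q * ‖x‖ ^ 2 * (if i = k then 1 else 0)))
        + Q * (x k * radialSymbol P Q R x j i k)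
        + R * x j * (2 * P + R * ‖x‖ ^ 2) * x i * (x k * x k)
        + (if i = k then (1 : ℝ) else 0) * (R * (x j * x k) * Q * ‖x‖ ^ 2) := by
    intro k
    ring
  simp only [expand, Finset.sum_add_distrib, ← Finset.mul_sum, sum_sq_coord,
    sum_radialSymbol_trace, sum_coord_mul_radialSymbol']
  simp only [ite_mul, one_mul, zero_mul, Finset.sum_ite_eq, Finset.mem_univ, if_true]
  ring

variable {P Q R x}

theorem HasPartials.radialSymbol {P Q R : ℝ → ℝ} {P' Q' R' : ℝ} (hx : x ∈ Ext n)
    (hP : HasDerivWithinAt P P' (Ici 1) ‖x‖) (hQ : HasDerivWithinAt Q Q' (Ici 1) ‖x‖)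
    (hR : HasDerivWithinAt R R' (Ici 1) ‖x‖) (k i j : Fin n) :
    HasPartials (fun y => radialSymbol (P ‖y‖) (Q ‖y‖) (R ‖y‖) y k i j)
      (fun l => radialSymbol (P' / ‖x‖) (Q' / ‖x‖) (R' / ‖x‖) x k i j * x l
        + P ‖x‖ * ((if i = l then 1 else 0) * (if j = k then 1 else 0)
          + (if j = l then 1 else 0) * (if i = k then 1 else 0))
        + Q ‖x‖ * (if i = j then 1 else 0) * (if k = l then 1 else 0)
        + R ‖x‖ * ((if i = l then 1 else 0) * (x j * x k) + (if j = l then 1 else 0) * (x i * x k)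
          + (if k = l then 1 else 0) * (x i * x j))) x := by
  have hc : ∀ i, HasPartials (fun y : E n => y i) _ x := fun i => HasPartials.coord hx i
  refine HasPartials.congr_partials (((HasPartials.radial hx hP).mul hx
    (((hc i).mul hx (HasPartials.const (if j = k then 1 else 0))).add hx
      ((hc j).mul hx (HasPartials.const (if i = k then 1 else 0))))).add hx
    (((HasPartials.radial hx hQ).mul hx (HasPartials.const (if i = j then 1 else 0))).mul hx
      (hc k)) |>.add hx ((HasPartials.radial hx hR).mul hx (((hc i).mul hx (hc j)).mul hx (hc k))))
    fun l => ?_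
  simp only [PenroseStability.radialSymbol]
  ring

/-- The Ricci tensor of a connection with radial symbols. -/
theorem ricci_of_radialSymbol {g : MetricField n} {P Q R : ℝ → ℝ} {P' Q' R' : ℝ} (hx : 1 < ‖x‖)
    (hg : ∀ y : E n, 1 < ‖y‖ → ∀ k i j,
      christoffel g k i j y = radialSymbol (P ‖y‖) (Q ‖y‖) (R ‖y‖) y k i j)
    (hP : HasDerivAt P P' ‖x‖) (hQ : HasDerivAt Q Q' ‖x‖) (hR : HasDerivAt R R' ‖x‖)
    (i j : Fin n) :
    ricci g i j x =
      (P' / ‖x‖ * (1 - n) - Q' / ‖x‖ + n * R ‖x‖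
        + ((n + 1) * P ‖x‖ + Q ‖x‖ + R ‖x‖ * ‖x‖ ^ 2) * (2 * P ‖x‖ + R ‖x‖ * ‖x‖ ^ 2)
        - ((n + 3) * P ‖x‖ ^ 2 + 2 * P ‖x‖ * Q ‖x‖ + 4 * P ‖x‖ * R ‖x‖ * ‖x‖ ^ 2 + Q ‖x‖ ^ 2
          + 2 * Q ‖x‖ * R ‖x‖ * ‖x‖ ^ 2 + R ‖x‖ ^ 2 * ‖x‖ ^ 4)) * (x i * x j)
      + (Q' / ‖x‖ * ‖x‖ ^ 2 + (1 - n) * P ‖x‖ + (n - 1) * Q ‖x‖ - R ‖x‖ * ‖x‖ ^ 2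
        + ((n + 1) * P ‖x‖ + Q ‖x‖ + R ‖x‖ * ‖x‖ ^ 2) * Q ‖x‖ * ‖x‖ ^ 2
        - 2 * P ‖x‖ * Q ‖x‖ * ‖x‖ ^ 2) * (if i = j then 1 else 0) := by
  have hx' : x ∈ Ext n := le_of_lt hx
  have hpd : ∀ k i j l, pd l (christoffel g k i j) x = _ := fun k i j =>
    ((HasPartials.radialSymbol hx' hP.hasDerivWithinAt hQ.hasDerivWithinAt hR.hasDerivWithinAt
      k i j).congr_interior hx (g := christoffel g k i j) (fun y hy => hg y hy k i j)).2
  rw [ricci]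
  simp only [hpd, hg x hx, if_true]
  generalize P' / ‖x‖ = p
  generalize Q' / ‖x‖ = q
  generalize R' / ‖x‖ = s
  generalize P ‖x‖ = P
  generalize Q ‖x‖ = Q
  generalize R ‖x‖ = R
  have e3 : ∑ k, ∑ l, (radialSymbol P Q R x k k l * radialSymbol P Q R x l i j
      - radialSymbol P Q R x k j l * radialSymbol P Q R x l i k)
      = ((n + 1) * P + Q + R * ‖x‖ ^ 2) * ((2 * P + R * ‖x‖ ^ 2) * (x i * x j)
          + Q * ‖x‖ ^ 2 * (if i = j then 1 else 0))
        - (((n + 3) * P ^ 2 + 2 * P * Q + 4 * P * R * ‖x‖ ^ 2 + Q ^ 2 + 2 * Q * R * ‖x‖ ^ 2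
          + R ^ 2 * ‖x‖ ^ 4) * (x i * x j)
        + 2 * P * Q * ‖x‖ ^ 2 * (if i = j then 1 else 0)) := by
    simp only [Finset.sum_sub_distrib, sum_radialSymbol_mul_radialSymbol]
    -- In `Γ^k_{kl} Γ^l_{ij}` the sum over `k` is a trace, so it has to be taken first, with `l`
    -- fixed.
    rw [Finset.sum_comm]
    simp only [← Finset.sum_mul, radialSymbol_comm P Q R x _ _ (_ : Fin n)]
    congr 1
    rw [← sum_coord_mul_radialSymbol, Finset.mul_sum]
    refine Finset.sum_congr rfl fun l _ => ?_
    rw [← mul_assoc, ← sum_radialSymbol_trace]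
  have e1 : ∀ k : Fin n, (radialSymbol p q s x k i j * x k
      + P * ((if i = k then 1 else 0) * (if j = k then 1 else 0)
          + (if j = k then 1 else 0) * (if i = k then 1 else 0))
        + Q * (if i = j then 1 else 0) * 1
        + R * ((if i = k then 1 else 0) * (x j * x k) + (if j = k then 1 else 0) * (x i * x k)
          + 1 * (x i * x j))
      - (radialSymbol p q s x k i k * x j
        + P * ((if i = j then 1 else 0) * 1
          + (if k = j then 1 else 0) * (if i = k then 1 else 0))
        + Q * (if i = k then 1 else 0) * (if k = j then 1 else 0)
        + R * ((if i = j then 1 else 0) * (x k * x k) + (if k = j then 1 else 0) * (x i * x k)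
          + (if k = j then 1 else 0) * (x i * x k))))
      = x k * radialSymbol p q s x k i j - x j * radialSymbol p q s x k i k
        + (if i = k then (1 : ℝ) else 0) * ((P - Q) * (if j = k then 1 else 0) + R * (x j * x k))
        + (if j = k then (1 : ℝ) else 0) * (- R * (x i * x k))
        + (Q * (if i = j then 1 else 0) + R * (x i * x j) - P * (if i = j then 1 else 0))
        - R * (if i = j then 1 else 0) * (x k * x k) := by
    intro k
    simp only [eq_comm (a := k) (b := j)]
    ring
  rw [e3, Finset.sum_congr rfl fun k _ => e1 k]
  simp only [Finset.sum_add_distrib, Finset.sum_sub_distrib, ← Finset.mul_sum, sum_sq_coord,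
    sum_radialSymbol_trace, sum_coord_mul_radialSymbol]
  simp only [ite_mul, one_mul, zero_mul, Finset.sum_ite_eq, Finset.mem_univ, if_true,
    Finset.sum_const, Finset.card_univ, Fintype.card_fin, nsmul_eq_mul, eq_comm (a := j) (b := i)]
  ring

end

section

variable {n : ℕ}

/-! ### Curvature of warped metrics -/

theorem gramMatrix_warpedMetric (r : ℝ → ℝ) {x : E n} (hx : x ∈ Ext n) (i j : Fin n) :
    gramMatrix (warpedMetric r) x i j = (r (‖x‖ - 1) / ‖x‖) ^ 2 * (if i = j then 1 else 0)
      + (1 - (r (‖x‖ - 1) / ‖x‖) ^ 2) / ‖x‖ ^ 2 * (x i * x j) := by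
  have h0 := (Ext.norm_pos hx).ne'
  simp only [gramMatrix, warpedMetric, Matrix.of_apply, EuclideanSpace.inner_single_right,
    one_mul, PiLp.single_apply, conj_trivial, eq_comm (a := j) (b := i)]
  field_simp
  ring

/-- The radial eigenvalue of the metric is `1`, so inverting the matrix only replaces `(R/ρ)²` by
its reciprocal; this is the relation that `inv_radial_matrix` asks for. -/
theorem warped_inv_coeff {R ρ : ℝ} (hR : R ≠ 0) (hρ : ρ ≠ 0) :
    (1 - (R / ρ) ^ 2) / ρ ^ 2 / (R / ρ) ^ 2
      + (1 - 1 / (R / ρ) ^ 2) / ρ ^ 2 * ((R / ρ) ^ 2 + (1 - (R / ρ) ^ 2) / ρ ^ 2 * ρ ^ 2) = 0 := by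
  field_simp
  ring

theorem hasDerivWithinAt_comp_sub_one {r : ℝ → ℝ} {r' ρ : ℝ}
    (hr : HasDerivWithinAt r r' (Ici 0) (ρ - 1)) :
    HasDerivWithinAt (fun t => r (t - 1)) r' (Ici 1) ρ := by
  have h := hr.comp (h := fun t : ℝ => t - 1) (s := Ici 1) ρ
    ((hasDerivAt_id ρ).sub_const 1).hasDerivWithinAt
    (fun t ht => sub_nonneg.mpr (show 1 ≤ t from ht))
  rwa [mul_one] at h

/-- A one-sided derivative of `r` is enough, so the symbols are available at `‖x‖ = 1`, where the
minimality of the boundary is read off. -/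
theorem christoffel_warpedMetric {r : ℝ → ℝ} {r' : ℝ} {x : E n} (hx : x ∈ Ext n)
    (hr : HasDerivWithinAt r r' (Ici 0) (‖x‖ - 1)) (hr0 : r (‖x‖ - 1) ≠ 0) (k i j : Fin n) :
    christoffel (warpedMetric r) k i j x
      = radialSymbol ((r' / r (‖x‖ - 1) - 1 / ‖x‖) / ‖x‖)
          (1 / ‖x‖ ^ 2 - r (‖x‖ - 1) * r' / ‖x‖ ^ 3)
          (r (‖x‖ - 1) * r' / ‖x‖ ^ 5 + 1 / ‖x‖ ^ 4 - 2 * r' / (r (‖x‖ - 1) * ‖x‖ ^ 3))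
          x k i j := by
  have h0 := (Ext.norm_pos hx).ne'
  have hq := (hasDerivWithinAt_comp_sub_one hr).div (hasDerivAt_id ‖x‖).hasDerivWithinAt h0
  have hA := hq.pow 2
  have hB := (hA.const_sub 1).div ((hasDerivAt_id ‖x‖).hasDerivWithinAt.pow 2) (pow_ne_zero 2 h0)
  rw [christoffel_of_radial (A := fun t => (r (t - 1) / t) ^ 2)
    (B := fun t => (1 - (r (t - 1) / t) ^ 2) / t ^ 2) hx
    (fun y hy i j => gramMatrix_warpedMetric r hy i j) hA hB
    (pow_ne_zero 2 (div_ne_zero hr0 h0)) (warped_inv_coeff hr0 h0), radialSymbol]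
  simp only [id, Pi.div_apply, Pi.pow_apply, Nat.reduceSub, pow_one, Nat.cast_ofNat]
  generalize r (‖x‖ - 1) = R at *
  generalize ‖x‖ = ρ at *
  congr 1
  · congr 1
    · congr 1
      field_simp
    · congr 2
      field_simp
      ring
  · congr 1
    field_simp
    ring

/-- The mean curvature of a symmetric sphere is `(n - 1) r' / r`. -/
theorem meanCurvature_eq {r : ℝ → ℝ} {r' : ℝ} {x : E n} (hx : x ∈ Ext n)
    (hr : HasDerivWithinAt r r' (Ici 0) (‖x‖ - 1)) (hr0 : r (‖x‖ - 1) ≠ 0) :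
    meanCurvature r x = (n - 1) * (r' / r (‖x‖ - 1)) := by
  have h0 := (Ext.norm_pos hx).ne'
  have hpd : ∀ i, pd i (fun y : E n => (‖y‖⁻¹ • y) i) x = _ := fun i =>
    (((HasPartials.radial hx (hasDerivAt_inv h0).hasDerivWithinAt).mul hx
      (HasPartials.coord hx i)).congr hx (g := fun y : E n => (‖y‖⁻¹ • y) i)
      (fun y _ => by simp)).2 i
  rw [meanCurvature, divergence, Finset.sum_comm]
  simp only [hpd, christoffel_warpedMetric hx hr hr0, if_true]
  have tr : ∀ P Q R : ℝ, ∑ j, ∑ i, radialSymbol P Q R x i i j * (‖x‖⁻¹ • x) j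
      = ((n + 1) * P + Q + R * ‖x‖ ^ 2) * ‖x‖ := by
    intro P Q R
    simp only [← Finset.sum_mul]
    have h1 : ∀ j, ∑ i, radialSymbol P Q R x i i j
        = ((n + 1) * P + Q + R * ‖x‖ ^ 2) * x j := fun j => by
      rw [← sum_radialSymbol_trace]
      simp only [radialSymbol_comm P Q R x _ j]
    have h2 : ∀ j, ((n + 1) * P + Q + R * ‖x‖ ^ 2) * x j * (‖x‖⁻¹ • x) j
        = ((n + 1) * P + Q + R * ‖x‖ ^ 2) * ‖x‖⁻¹ * (x j * x j) := fun j => by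
      simp only [PiLp.smul_apply, smul_eq_mul]
      ring
    simp only [h1, h2, ← Finset.mul_sum, sum_sq_coord]
    field_simp
  have tr' : ∀ c : ℝ, ∑ i : Fin n, (‖x‖⁻¹ * 1 + x i * (c * x i))
      = n * ‖x‖⁻¹ + c * ‖x‖ ^ 2 := by
    intro c
    simp only [mul_left_comm (x _) c, Finset.sum_add_distrib, ← Finset.mul_sum, sum_sq_coord]
    simp [mul_comm]
  rw [tr, tr']
  field_simp
  ring

/-- The scalar curvature of a warped metric. -/
theorem scalarCurvature_warpedMetric {r r' : ℝ → ℝ} {r'' : ℝ} {x : E n} (hx : 1 < ‖x‖)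
    (hr : ∀ s, 0 < s → HasDerivAt r (r' s) s) (hr' : HasDerivAt r' r'' (‖x‖ - 1))
    (hr0 : ∀ s, 0 < s → r s ≠ 0) :
    scalarCurvature (warpedMetric r) x = (n - 1) *
      ((n - 2) * (1 - r' (‖x‖ - 1) ^ 2) / r (‖x‖ - 1) ^ 2 - 2 * r'' / r (‖x‖ - 1)) := by
  have hx' : x ∈ Ext n := le_of_lt hx
  have h0 := (Ext.norm_pos hx').ne'
  have hs : 0 < ‖x‖ - 1 := sub_pos.mpr hx
  have hR := hr0 _ hs
  have hsub : HasDerivAt (fun t : ℝ => t - 1) 1 ‖x‖ := (hasDerivAt_id _).sub_const 1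
  have hid := hasDerivAt_id ‖x‖
  have d0 : HasDerivAt (fun t => r (t - 1)) (r' (‖x‖ - 1)) ‖x‖ := by
    have := (hr _ hs).comp ‖x‖ hsub
    rwa [mul_one] at this
  have d1 : HasDerivAt (fun t => r' (t - 1)) r'' ‖x‖ := by
    have := hr'.comp ‖x‖ hsub
    rwa [mul_one] at this
  have hP := ((d1.div d0 hR).sub ((hasDerivAt_const ‖x‖ (1 : ℝ)).div hid h0)).div hid h0
  have hQ := ((hasDerivAt_const ‖x‖ (1 : ℝ)).div (hid.pow 2) (pow_ne_zero 2 h0)).sub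
    ((d0.mul d1).div (hid.pow 3) (pow_ne_zero 3 h0))
  have hS := (((d0.mul d1).div (hid.pow 5) (pow_ne_zero 5 h0)).add
    ((hasDerivAt_const ‖x‖ (1 : ℝ)).div (hid.pow 4) (pow_ne_zero 4 h0))).sub
    ((d1.const_mul 2).div (d0.mul (hid.pow 3)) (mul_ne_zero hR (pow_ne_zero 3 h0)))
  have hricci := ricci_of_radialSymbol (g := warpedMetric r)
    (P := fun t => (r' (t - 1) / r (t - 1) - 1 / t) / t)
    (Q := fun t => 1 / t ^ 2 - r (t - 1) * r' (t - 1) / t ^ 3)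
    (R := fun t => r (t - 1) * r' (t - 1) / t ^ 5 + 1 / t ^ 4
      - 2 * r' (t - 1) / (r (t - 1) * t ^ 3))
    hx (fun y hy k i j => christoffel_warpedMetric (le_of_lt hy)
      (hr _ (sub_pos.mpr hy)).hasDerivWithinAt (hr0 _ (sub_pos.mpr hy)) k i j) hP hQ hS
  have hG : gramMatrix (warpedMetric r) x = Matrix.of fun i j : Fin n =>
      (r (‖x‖ - 1) / ‖x‖) ^ 2 * (if i = j then 1 else 0)
        + (1 - (r (‖x‖ - 1) / ‖x‖) ^ 2) / ‖x‖ ^ 2 * (x i * x j) := by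
    ext i j
    exact gramMatrix_warpedMetric r hx' i j
  have hinv := inv_radial_matrix x (pow_ne_zero 2 (div_ne_zero hR h0)) (warped_inv_coeff hR h0)
  rw [← hG] at hinv
  rw [scalarCurvature, hinv]
  have trace : ∀ a c U V : ℝ, ∑ i : Fin n, ∑ j : Fin n,
      (a * (if i = j then 1 else 0) + c * (x i * x j)) *
        (V * (x i * x j) + U * (if i = j then 1 else 0))
      = a * (n * U + V * ‖x‖ ^ 2) + c * (U * ‖x‖ ^ 2 + V * ‖x‖ ^ 4) := by
    intro a c U V
    have expand : ∀ i j : Fin n, (a * (if i = j then 1 else 0) + c * (x i * x j)) *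
        (V * (x i * x j) + U * (if i = j then 1 else 0))
        = (if i = j then (1 : ℝ) else 0) * (a * V * (x i * x j) + a * U * (if i = j then 1 else 0)
            + c * U * (x i * x j)) + c * V * (x i * x i) * (x j * x j) := fun i j => by ring
    simp only [expand, Finset.sum_add_distrib, ← Finset.mul_sum, ← Finset.sum_mul, sum_sq_coord]
    simp only [ite_mul, one_mul, zero_mul, Finset.sum_ite_eq, Finset.mem_univ, if_true,
      Finset.sum_add_distrib, ← Finset.mul_sum, sum_sq_coord, Finset.sum_const, Finset.card_univ,
      Fintype.card_fin, nsmul_eq_mul]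
    ring
  simp only [hricci, Matrix.of_apply, trace]
  simp only [id, Pi.div_apply, Pi.pow_apply, Pi.mul_apply, Pi.sub_apply, Nat.reduceSub, pow_one,
    Nat.cast_ofNat]
  generalize r (‖x‖ - 1) = R at *
  generalize r' (‖x‖ - 1) = R' at *
  generalize ‖x‖ = ρ at *
  field_simp
  ring

end

section

/-! ### Radius profiles of nonnegative scalar curvature -/

/-- The radius profile `r` with derivative `q`: its Hawking mass lies between `r(0)^k / 2` and
`(1 + δ) r(0)^k / 2`. -/
structure RadiusProfile (k : ℕ) (δ : ℝ) (r q : ℝ → ℝ) : Prop where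
  pos : 0 < r 0
  continuousOn : ContinuousOn r (Ici 0)
  hasDerivAt : ∀ s, 0 < s → HasDerivAt r (q s) s
  continuousOn_deriv : ContinuousOn q (Ici 0)
  deriv_pos : ∀ s, 0 < s → 0 < q s
  le_mass : ∀ s, 0 ≤ s → r 0 ^ k ≤ r s ^ k * (1 - q s ^ 2)
  mass_le : ∀ s, 0 ≤ s → r s ^ k * (1 - q s ^ 2) ≤ (1 + δ) * r 0 ^ k
  tendsto : Tendsto r atTop atTop

theorem unitSphereArea_pos {n : ℕ} (hn : 3 ≤ n) : 0 < unitSphereArea n := by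
  have : Nonempty (Fin n) := ⟨⟨0, by omega⟩⟩
  rw [unitSphereArea, Measure.toSphere_real_apply_univ]
  refine mul_pos ?_ ?_
  · simp; omega
  · exact ENNReal.toReal_pos (Metric.measure_ball_pos _ _ one_pos).ne' measure_ball_lt_top.ne

theorem exists_norm_eq {n : ℕ} (hn : 3 ≤ n) {t : ℝ} (ht : 0 ≤ t) : ∃ x : E n, ‖x‖ = t :=
  ⟨EuclideanSpace.single ⟨0, by omega⟩ t, by simp [abs_of_nonneg ht]⟩

/-! ### Consequences of the curvature and boundary conditions for the radius function. -/

namespace RotSym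

variable {n : ℕ} {r : ℝ → ℝ}

theorem hasDerivWithinAt (hM : RotSym n r) {s : ℝ} (hs : 0 ≤ s) :
    HasDerivWithinAt r (derivWithin r (Ici 0) s) (Ici 0) s :=
  ((hM.smooth.differentiableOn (by simp)) s hs).hasDerivWithinAt

theorem hasDerivAt (hM : RotSym n r) {s : ℝ} (hs : 0 < s) :
    HasDerivAt r (derivWithin r (Ici 0) s) s :=
  (hM.hasDerivWithinAt hs.le).hasDerivAt (Ici_mem_nhds hs)

theorem contDiffOn_deriv (hM : RotSym n r) : ContDiffOn ℝ ∞ (derivWithin r (Ici 0)) (Ici 0) :=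
  hM.smooth.derivWithin (uniqueDiffOn_Ici 0) (by simp)

theorem isMinimalSphere_iff (hn : 3 ≤ n) (hM : RotSym n r) {s : ℝ} (hs : 0 ≤ s) :
    IsMinimalSphere n r s ↔ derivWithin r (Ici 0) s = 0 := by
  have hn1 : (n : ℝ) - 1 ≠ 0 := by
    have : (3 : ℝ) ≤ n := by exact_mod_cast hn
    linarith
  have key : ∀ x ∈ symSphere n s,
      meanCurvature r x = (n - 1) * (derivWithin r (Ici 0) s / r s) := by
    intro x hx
    have hx : ‖x‖ = 1 + s := by simpa [symSphere] using hx
    have hx' : ‖x‖ - 1 = s := by rw [hx]; ring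
    have h := meanCurvature_eq (x := x) (r := r) (r' := derivWithin r (Ici 0) s)
      (show 1 ≤ ‖x‖ by linarith) (by rw [hx']; exact hM.hasDerivWithinAt hs)
      (by rw [hx']; exact (hM.pos s hs).ne')
    rwa [hx'] at h
  constructor
  · intro h
    obtain ⟨x, hx⟩ := exists_norm_eq hn (by linarith : 0 ≤ 1 + s)
    have hx : x ∈ symSphere n s := by simpa [symSphere] using hx
    have := (key x hx).symm.trans (h x hx)
    simpa [hn1, (hM.pos s hs).ne'] using this
  · intro h x hx
    rw [key x hx, h]
    simp

/-- No sphere with `s > 0` is minimal, so `r'` has no zero there and keeps one sign by Darboux's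
theorem; a negative sign contradicts `r → ∞`. -/
theorem deriv_pos (hn : 3 ≤ n) (hM : RotSym n r) {s : ℝ} (hs : 0 < s) :
    0 < derivWithin r (Ici 0) s := by
  rcases hasDerivWithinAt_forall_lt_or_forall_gt_of_forall_ne (convex_Ioi (0 : ℝ))
    (fun t ht => (hM.hasDerivAt ht).hasDerivWithinAt)
    (fun t ht => fun h => hM.outermost t ht ((isMinimalSphere_iff hn hM (le_of_lt ht)).mpr h))
    with h | h
  · exfalso
    have hanti : StrictAntiOn r (Ici 0) := by
      refine strictAntiOn_of_deriv_neg (convex_Ici 0) hM.smooth.continuousOn fun t ht => ?_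
      rw [interior_Ici] at ht
      rw [(hM.hasDerivAt ht).deriv]
      exact h t ht
    obtain ⟨t, ht, ht'⟩ := ((hM.tendsto_radius.eventually_gt_atTop (r 0)).and
      (eventually_gt_atTop 0)).exists
    exact lt_asymm ht (hanti self_mem_Ici (le_of_lt ht') ht')
  · exact h s hs

/-- The derivative of the Hawking mass is `r^{n-1} r' / (2(n-1))` times the scalar curvature, and
both factors are nonnegative. -/
theorem monotoneOn_hawkingMass (hn : 3 ≤ n) (hM : RotSym n r) :
    MonotoneOn (hawkingMass n r) (Ici 0) := by
  set q := derivWithin r (Ici 0) with hq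
  -- With `n = k + 3` the truncated exponent `n - 2` becomes `k + 1`, which can be differentiated as
  -- a successor.
  obtain ⟨k, rfl⟩ : ∃ k, n = k + 3 := ⟨n - 3, by omega⟩
  have hd : ∀ s, 0 < s → HasDerivAt (hawkingMass (k + 3) r)
      (r s ^ (k + 2) * q s / 2 * ((k + 1) * (1 - q s ^ 2) / r s ^ 2 - 2 * deriv q s / r s)) s := by
    intro s hs
    have h1 : HasDerivAt q (deriv q s) s :=
      ((hM.contDiffOn_deriv.differentiableOn (by simp) s hs.le).differentiableAt
        (Ici_mem_nhds hs)).hasDerivAt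
    have h2 := (((hM.hasDerivAt hs).pow (k + 1)).div_const 2).mul ((h1.pow 2).const_sub 1)
    have h0 := (hM.pos s hs.le).ne'
    refine HasDerivAt.congr_deriv (f := hawkingMass (k + 3) r) h2 ?_
    simp only [Pi.pow_apply, ← hq]
    push_cast
    field_simp
    ring
  refine monotoneOn_of_deriv_nonneg (convex_Ici 0) ?_ ?_ ?_
  · exact ((hM.smooth.continuousOn.pow _).div_const 2).mul
      (continuousOn_const.sub (hM.contDiffOn_deriv.continuousOn.pow 2))
  · intro s hs
    rw [interior_Ici] at hs
    exact (hd s hs).differentiableAt.differentiableWithinAt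
  · intro s hs
    rw [interior_Ici] at hs
    have hs : 0 < s := hs
    rw [(hd s hs).deriv]
    refine mul_nonneg (div_nonneg (mul_nonneg (pow_nonneg (hM.pos s hs.le).le _)
      (deriv_pos hn hM hs).le) zero_le_two) ?_
    obtain ⟨x, hx⟩ := exists_norm_eq hn (by linarith : 0 ≤ 1 + s)
    have hx' : ‖x‖ - 1 = s := by rw [hx]; ring
    have h1 : HasDerivAt q (deriv q s) s :=
      ((hM.contDiffOn_deriv.differentiableOn (by simp) s hs.le).differentiableAt
        (Ici_mem_nhds hs)).hasDerivAt
    have h := hM.scalarCurvature_nonneg x (show 1 ≤ ‖x‖ by linarith)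
    rw [scalarCurvature_warpedMetric (r := r) (r' := q) (by linarith)
      (fun t ht => hM.hasDerivAt ht) (by rw [hx']; exact h1) (fun t ht => (hM.pos t ht.le).ne'),
      hx'] at h
    push_cast at h
    have h3 := nonneg_of_mul_nonneg_right h (by linarith [(Nat.cast_nonneg k : (0 : ℝ) ≤ k)])
    convert h3 using 4
    ring

theorem sphereArea_div (hn : 3 ≤ n) (hM : RotSym n r) :
    (sphereArea n r 0 / unitSphereArea n) ^ (((n : ℝ) - 2) / ((n : ℝ) - 1)) = r 0 ^ (n - 2) := by
  have h0 := hM.pos 0 le_rfl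
  have hn' : (3 : ℝ) ≤ n := by exact_mod_cast hn
  rw [sphereArea, mul_div_cancel_left₀ _ (unitSphereArea_pos hn).ne', ← Real.rpow_natCast,
    ← Real.rpow_mul h0.le, ← Real.rpow_natCast]
  congr 1
  rw [Nat.cast_sub (by omega), Nat.cast_sub (by omega)]
  push_cast
  have : (n : ℝ) - 1 ≠ 0 := by linarith
  field_simp

/-- Monotonicity squeezes the Hawking mass between its value at the boundary, where `r' = 0`, and
its limit, the ADM mass. -/
theorem radiusProfile (hn : 3 ≤ n) (hM : RotSym n r) {δ : ℝ}
    (hmass : HasADMMass n r ((1 + δ) / 2 * (sphereArea n r 0 / unitSphereArea n)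
        ^ (((n : ℝ) - 2) / ((n : ℝ) - 1)))) :
    RadiusProfile (n - 2) δ r (derivWithin r (Ici 0)) := by
  rw [sphereArea_div hn hM] at hmass
  have hmono := monotoneOn_hawkingMass hn hM
  have h00 := (isMinimalSphere_iff hn hM le_rfl).mp hM.boundary_minimal
  refine ⟨hM.pos 0 le_rfl, hM.smooth.continuousOn, fun s hs => hM.hasDerivAt hs,
    hM.contDiffOn_deriv.continuousOn, fun s hs => deriv_pos hn hM hs, fun s hs => ?_,
    fun s hs => ?_, hM.tendsto_radius⟩
  · have h := hmono self_mem_Ici hs hs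
    simp only [hawkingMass, h00] at h
    linarith
  · have h := ge_of_tendsto hmass ((eventually_ge_atTop s).mono
      fun t ht => hmono hs (le_trans hs ht) ht)
    simp only [hawkingMass] at h
    linarith

end RotSym

end

section

/-! ### Schwarzschild spaces -/

variable {n : ℕ} {m : ℝ}

theorem horizonRadius_pos (hm : 0 < m) : 0 < horizonRadius n m :=
  Real.rpow_pos_of_pos (by linarith) _

theorem horizonRadius_pow (hn : 3 ≤ n) (hm : 0 < m) : horizonRadius n m ^ (n - 2) = 2 * m := by
  have hn' : (3 : ℝ) ≤ n := by exact_mod_cast hn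
  rw [horizonRadius, ← Real.rpow_natCast, ← Real.rpow_mul (by linarith), Nat.cast_sub (by omega)]
  push_cast
  rw [one_div_mul_cancel (by linarith), Real.rpow_one]

/-- The Schwarzschild potential `1 - 2 m / t^{n-2}`. -/
def schPotential (n : ℕ) (m t : ℝ) : ℝ := 1 - 2 * m / t ^ (n - 2)

/-- With `a` the horizon radius, `V = 1 - (a/t)^{n-2}` and `(a/t)^{n-2} ≤ a/t`. The potential thus
vanishes at most linearly at the horizon, which makes `V^{-1/2}` integrable there. -/
theorem le_schPotential (hn : 3 ≤ n) (hm : 0 < m) {t : ℝ} (ht : horizonRadius n m ≤ t) :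
    (t - horizonRadius n m) / t ≤ schPotential n m t := by
  have ha := horizonRadius_pos (n := n) hm
  have ht0 : 0 < t := lt_of_lt_of_le ha ht
  rw [schPotential, ← horizonRadius_pow hn hm, sub_div, div_self ht0.ne', ← div_pow]
  have h1 : horizonRadius n m / t ≤ 1 := (div_le_one ht0).mpr ht
  have := pow_le_of_le_one (div_pos ha ht0).le h1 (by omega : n - 2 ≠ 0)
  linarith

theorem schPotential_pos (hn : 3 ≤ n) (hm : 0 < m) {t : ℝ} (ht : horizonRadius n m < t) :
    0 < schPotential n m t :=
  lt_of_lt_of_le (div_pos (sub_pos.mpr ht) ((horizonRadius_pos hm).trans ht))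
    (le_schPotential hn hm ht.le)

theorem schPotential_le_one (hm : 0 < m) {t : ℝ} (ht : horizonRadius n m ≤ t) :
    schPotential n m t ≤ 1 := by
  have : 0 ≤ 2 * m / t ^ (n - 2) :=
    div_nonneg (by linarith) (pow_nonneg ((horizonRadius_pos hm).le.trans ht) _)
  rw [schPotential]
  linarith

/-- The integrand is dominated by `√ρ (t - a)^{-1/2}`, `a` being the horizon radius, and the
exponent exceeds `-1`. -/
theorem intervalIntegrable_sch (hn : 3 ≤ n) (hm : 0 < m) {ρ : ℝ} (hρ : horizonRadius n m ≤ ρ) :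
    IntervalIntegrable (fun t => (Real.sqrt (schPotential n m t))⁻¹) volume
      (horizonRadius n m) ρ := by
  have ha := horizonRadius_pos (n := n) hm
  have h1 : IntervalIntegrable
      (fun t => Real.sqrt ρ * (t - horizonRadius n m) ^ (-(1 / 2) : ℝ)) volume
      (horizonRadius n m) ρ := by
    have := (intervalIntegral.intervalIntegrable_rpow' (a := 0) (b := ρ - horizonRadius n m)
      (r := -(1 / 2)) (by norm_num)).comp_sub_right (horizonRadius n m)
    simp only [zero_add, sub_add_cancel] at this
    exact this.const_mul _
  refine h1.mono_fun' ?_ ?_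
  · refine Measurable.aestronglyMeasurable ?_
    unfold schPotential
    fun_prop
  · rw [uIoc_of_le hρ]
    refine (ae_restrict_iff' measurableSet_Ioc).mpr (Eventually.of_forall fun t ht => ?_)
    have ht0 : 0 < t := ha.trans ht.1
    have hta : 0 < t - horizonRadius n m := sub_pos.mpr ht.1
    have hρ0 : 0 < ρ := ha.trans_le hρ
    have hV := schPotential_pos hn hm ht.1
    beta_reduce
    rw [Real.norm_of_nonneg (by positivity), Real.rpow_neg hta.le, ← Real.sqrt_eq_rpow,
      ← div_eq_mul_inv, ← Real.sqrt_div' _ hta.le, ← Real.sqrt_inv]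
    refine Real.sqrt_le_sqrt ?_
    rw [inv_le_comm₀ hV (by positivity), inv_div]
    exact (div_le_div_of_nonneg_left hta.le ht0 ht.2).trans (le_schPotential hn hm ht.1.le)

/-! ### The Schwarzschild distance as a bijection, and its inverse. -/

theorem schDistance_horizonRadius : schDistance n m (horizonRadius n m) = 0 :=
  intervalIntegral.integral_same

theorem continuousOn_schDistance (hn : 3 ≤ n) (hm : 0 < m) :
    ContinuousOn (schDistance n m) (Ici (horizonRadius n m)) := by
  intro ρ hρ
  have hle : horizonRadius n m ≤ ρ + 1 := by linarith [show horizonRadius n m ≤ ρ from hρ]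
  have h := intervalIntegral.continuousOn_primitive_interval'
    (intervalIntegrable_sch hn hm hle) left_mem_uIcc
  rw [uIcc_of_le hle] at h
  refine (h ρ ⟨hρ, by linarith⟩).mono_of_mem_nhdsWithin ?_
  rw [← Ici_inter_Iic]
  exact inter_mem_nhdsWithin _ (Iic_mem_nhds (by linarith))

theorem hasDerivAt_schDistance (hn : 3 ≤ n) (hm : 0 < m) {ρ : ℝ} (hρ : horizonRadius n m < ρ) :
    HasDerivAt (schDistance n m) (Real.sqrt (schPotential n m ρ))⁻¹ ρ := by
  have hρ0 : 0 < ρ := (horizonRadius_pos hm).trans hρ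
  refine intervalIntegral.integral_hasDerivAt_right (intervalIntegrable_sch hn hm hρ.le) ?_ ?_
  · refine Measurable.stronglyMeasurable ?_ |>.stronglyMeasurableAtFilter
    fun_prop
  · refine ContinuousAt.inv₀ ?_ (Real.sqrt_pos.mpr (schPotential_pos hn hm hρ)).ne'
    refine ContinuousAt.sqrt (continuousAt_const.sub (continuousAt_const.div ?_ ?_))
    · exact continuousAt_id.pow _
    · exact (pow_pos hρ0 _).ne'

theorem one_le_deriv_schDistance (hn : 3 ≤ n) (hm : 0 < m) {ρ : ℝ} (hρ : horizonRadius n m < ρ) :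
    1 ≤ (Real.sqrt (schPotential n m ρ))⁻¹ := by
  refine (one_le_inv₀ (Real.sqrt_pos.mpr (schPotential_pos hn hm hρ))).mpr ?_
  exact Real.sqrt_le_one.mpr (schPotential_le_one hm hρ.le)

/-- The integrand is at least `1` because `V ≤ 1`. This single inequality yields strict
monotonicity, unboundedness, and the Lipschitz continuity of the inverse. -/
theorem sub_le_schDistance_sub (hn : 3 ≤ n) (hm : 0 < m) {ρ ρ' : ℝ}
    (hρ : horizonRadius n m ≤ ρ) (h : ρ ≤ ρ') :
    ρ' - ρ ≤ schDistance n m ρ' - schDistance n m ρ := by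
  have hmono : MonotoneOn (fun t => schDistance n m t - t) (Ici (horizonRadius n m)) := by
    refine monotoneOn_of_deriv_nonneg (convex_Ici _)
      ((continuousOn_schDistance hn hm).sub continuousOn_id) ?_ ?_
    · intro t ht
      rw [interior_Ici] at ht
      exact ((hasDerivAt_schDistance hn hm ht).sub (hasDerivAt_id t)).differentiableAt
        |>.differentiableWithinAt
    · intro t ht
      rw [interior_Ici] at ht
      have h1 := ((hasDerivAt_schDistance hn hm ht).sub (hasDerivAt_id t)).deriv
      have h2 := one_le_deriv_schDistance hn hm ht
      have h3 : deriv (fun t => schDistance n m t - t) t = _ := h1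
      rw [h3]
      linarith
  have := hmono hρ (hρ.trans h) h
  simp only at this
  linarith

theorem strictMonoOn_schDistance (hn : 3 ≤ n) (hm : 0 < m) :
    StrictMonoOn (schDistance n m) (Ici (horizonRadius n m)) := fun ρ hρ ρ' _ h => by
  linarith [sub_le_schDistance_sub hn hm hρ h.le]

theorem bijOn_schDistance (hn : 3 ≤ n) (hm : 0 < m) :
    BijOn (schDistance n m) (Ici (horizonRadius n m)) (Ici 0) := by
  refine ⟨fun ρ hρ => ?_, (strictMonoOn_schDistance hn hm).injOn, fun s hs => ?_⟩
  · have := sub_le_schDistance_sub hn hm le_rfl hρ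
    rw [schDistance_horizonRadius] at this
    have h1 : horizonRadius n m ≤ ρ := hρ
    exact show 0 ≤ schDistance n m ρ by linarith
  · have hs : 0 ≤ s := hs
    have h1 := sub_le_schDistance_sub hn hm le_rfl
      (le_add_of_nonneg_right hs : horizonRadius n m ≤ horizonRadius n m + s)
    rw [schDistance_horizonRadius] at h1
    have h2 := intermediate_value_Icc (le_add_of_nonneg_right hs)
      ((continuousOn_schDistance hn hm).mono (fun t ht => ht.1))
    obtain ⟨ρ, hρ, rfl⟩ := h2 (show s ∈ _ from ⟨by rwa [schDistance_horizonRadius], by linarith⟩)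
    exact ⟨ρ, hρ.1, rfl⟩

theorem schRadius_schDistance (hn : 3 ≤ n) (hm : 0 < m) {ρ : ℝ} (hρ : horizonRadius n m ≤ ρ) :
    schRadius n m (schDistance n m ρ) = ρ :=
  (bijOn_schDistance hn hm).invOn_invFunOn.1 hρ

theorem schDistance_schRadius (hn : 3 ≤ n) (hm : 0 < m) {s : ℝ} (hs : 0 ≤ s) :
    schDistance n m (schRadius n m s) = s :=
  (bijOn_schDistance hn hm).invOn_invFunOn.2 hs

theorem horizonRadius_le_schRadius (hn : 3 ≤ n) (hm : 0 < m) {s : ℝ} (hs : 0 ≤ s) :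
    horizonRadius n m ≤ schRadius n m s :=
  (bijOn_schDistance hn hm).surjOn.mapsTo_invFunOn hs

theorem schRadius_zero (hn : 3 ≤ n) (hm : 0 < m) : schRadius n m 0 = horizonRadius n m := by
  have := schRadius_schDistance hn hm (le_refl (horizonRadius n m))
  rwa [schDistance_horizonRadius] at this

theorem strictMonoOn_schRadius (hn : 3 ≤ n) (hm : 0 < m) :
    StrictMonoOn (schRadius n m) (Ici 0) := fun s hs s' hs' h => by
  refine ((strictMonoOn_schDistance hn hm).lt_iff_lt (horizonRadius_le_schRadius hn hm hs)
    (horizonRadius_le_schRadius hn hm hs')).mp ?_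
  rwa [schDistance_schRadius hn hm hs, schDistance_schRadius hn hm hs']

theorem continuousOn_schRadius (hn : 3 ≤ n) (hm : 0 < m) :
    ContinuousOn (schRadius n m) (Ici 0) := by
  have key : ∀ s, 0 ≤ s → ∀ s', s ≤ s' → |schRadius n m s - schRadius n m s'| ≤ |s - s'| := by
    intro s hs s' h
    have h1 := (strictMonoOn_schRadius hn hm).monotoneOn hs (hs.trans h) h
    have h2 := sub_le_schDistance_sub hn hm (horizonRadius_le_schRadius hn hm hs) h1
    rw [schDistance_schRadius hn hm hs, schDistance_schRadius hn hm (hs.trans h)] at h2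
    rw [abs_sub_comm, abs_sub_comm s s', abs_of_nonneg (sub_nonneg.mpr h1),
      abs_of_nonneg (sub_nonneg.mpr h)]
    exact h2
  refine LipschitzOnWith.continuousOn (K := 1) (LipschitzOnWith.of_dist_le_mul ?_)
  intro s hs s' hs'
  rw [NNReal.coe_one, one_mul, Real.dist_eq, Real.dist_eq]
  rcases le_total s s' with h | h
  · exact key s hs s' h
  · rw [abs_sub_comm, abs_sub_comm s s']
    exact key s' hs' s h

theorem hasDerivAt_schRadius (hn : 3 ≤ n) (hm : 0 < m) {s : ℝ} (hs : 0 < s) :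
    HasDerivAt (schRadius n m) (Real.sqrt (schPotential n m (schRadius n m s))) s := by
  have h1 : horizonRadius n m < schRadius n m s := by
    rw [← schRadius_zero hn hm]
    exact strictMonoOn_schRadius hn hm self_mem_Ici hs.le hs
  have h2 := HasDerivAt.of_local_left_inverse
    ((continuousOn_schRadius hn hm).continuousAt (Ici_mem_nhds hs))
    (hasDerivAt_schDistance hn hm h1)
    (inv_ne_zero (Real.sqrt_pos.mpr (schPotential_pos hn hm h1)).ne')
    ((eventually_gt_nhds hs).mono fun t ht => schDistance_schRadius hn hm (le_of_lt ht))
  rwa [inv_inv] at h2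

/-! ### Height of the Schwarzschild graph -/

/-- The slope of the height of the Schwarzschild graph, as a function of the distance. -/
def schSlope (n : ℕ) (m s : ℝ) : ℝ := Real.sqrt (2 * m / schRadius n m s ^ (n - 2))

theorem continuousOn_schSlope (hn : 3 ≤ n) (hm : 0 < m) : ContinuousOn (schSlope n m) (Ici 0) :=
  (continuousOn_const.div ((continuousOn_schRadius hn hm).pow _) fun _ hs =>
    (pow_pos ((horizonRadius_pos hm).trans_le (horizonRadius_le_schRadius hn hm hs)) _).ne').sqrt

/-- Since `(dr/ds)² = V`, the slope `√(1 - V)` depends on the radius alone and is continuous up to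
the horizon. The derivative of `schRadius` is only computed for `u > 0`, which suffices under the
integral. -/
theorem graphHeight_schRadius (hn : 3 ≤ n) (hm : 0 < m) {σ : ℝ} (hσ : 0 ≤ σ) :
    graphHeight (schRadius n m) σ = ∫ u in (0 : ℝ)..σ, schSlope n m u := by
  rw [graphHeight]
  refine intervalIntegral.integral_congr_ae (Eventually.of_forall fun u hu => ?_)
  rw [uIoc_of_le hσ] at hu
  have h := (hasDerivAt_schRadius hn hm hu.1)
  have h1 : horizonRadius n m ≤ schRadius n m u := horizonRadius_le_schRadius hn hm hu.1.le
  have hV : 0 ≤ schPotential n m (schRadius n m u) :=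
    (div_nonneg (sub_nonneg.mpr h1) ((horizonRadius_pos hm).le.trans h1)).trans
      (le_schPotential hn hm h1)
  rw [h.hasDerivWithinAt.derivWithin (uniqueDiffOn_Ici 0 u hu.1.le),
    Real.sq_sqrt hV, schSlope, schPotential, sub_sub_cancel]

end

section

/-! ### Comparison of a radius profile with the Schwarzschild profile -/

namespace RadiusProfile

variable {n : ℕ} {m δ : ℝ} {r q : ℝ → ℝ}

section

variable {k : ℕ}

theorem strictMonoOn (h : RadiusProfile k δ r q) : StrictMonoOn r (Ici 0) :=
  strictMonoOn_of_deriv_pos (convex_Ici 0) h.continuousOn fun s hs => by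
    rw [interior_Ici] at hs
    rw [(h.hasDerivAt s hs).deriv]
    exact h.deriv_pos s hs

theorem zero_le (h : RadiusProfile k δ r q) {s : ℝ} (hs : 0 ≤ s) : r 0 ≤ r s :=
  h.strictMonoOn.monotoneOn self_mem_Ici hs hs

theorem pos' (h : RadiusProfile k δ r q) {s : ℝ} (hs : 0 ≤ s) : 0 < r s :=
  h.pos.trans_le (h.zero_le hs)

theorem exists_eq (h : RadiusProfile k δ r q) {R : ℝ} (hR : r 0 ≤ R) : ∃ s, 0 ≤ s ∧ r s = R := by
  obtain ⟨t, ht, ht'⟩ := ((h.tendsto.eventually_ge_atTop R).and (eventually_ge_atTop 0)).exists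
  obtain ⟨s, hs, rfl⟩ := intermediate_value_Icc ht' (h.continuousOn.mono fun u hu => hu.1) ⟨hR, ht⟩
  exact ⟨s, hs.1, rfl⟩

end

theorem horizonRadius_le (ha : horizonRadius n m = r 0)
    (h : RadiusProfile (n - 2) δ r q) {s : ℝ} (hs : 0 ≤ s) :
    horizonRadius n m ≤ r s := ha ▸ h.zero_le hs

theorem horizonRadius_lt (ha : horizonRadius n m = r 0)
    (h : RadiusProfile (n - 2) δ r q) {s : ℝ} (hs : 0 < s) : horizonRadius n m < r s :=
  ha ▸ h.strictMonoOn self_mem_Ici hs.le hs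

theorem div_le_one_sub_sq (hn : 3 ≤ n) (hm : 0 < m) (ha : horizonRadius n m = r 0)
    (h : RadiusProfile (n - 2) δ r q) {s : ℝ} (hs : 0 ≤ s) :
    2 * m / r s ^ (n - 2) ≤ 1 - q s ^ 2 := by
  rw [div_le_iff₀ (pow_pos (h.pos' hs) _), ← horizonRadius_pow hn hm, ha]
  linarith [h.le_mass s hs]

theorem one_sub_sq_le (hn : 3 ≤ n) (hm : 0 < m) (ha : horizonRadius n m = r 0)
    (h : RadiusProfile (n - 2) δ r q) {s : ℝ} (hs : 0 ≤ s) :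
    1 - q s ^ 2 ≤ (1 + δ) * (2 * m / r s ^ (n - 2)) := by
  rw [← mul_div_assoc, le_div_iff₀ (pow_pos (h.pos' hs) _), ← horizonRadius_pow hn hm, ha]
  linarith [h.mass_le s hs]

theorem sq_le_schPotential (hn : 3 ≤ n) (hm : 0 < m) (ha : horizonRadius n m = r 0)
    (h : RadiusProfile (n - 2) δ r q) {s : ℝ} (hs : 0 ≤ s) : q s ^ 2 ≤ schPotential n m (r s) := by
  rw [schPotential]
  linarith [div_le_one_sub_sq hn hm ha h hs]

/-- If `r(s)^{n-2} ≥ 2 m (1 + √δ)` then `(dr/ds)²` is at least `(1 - √δ)` times its Schwarzschild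
value. -/
theorem mul_schPotential_le_sq (hn : 3 ≤ n) (hm : 0 < m) (ha : horizonRadius n m = r 0)
    (h : RadiusProfile (n - 2) δ r q) (hδ : 0 ≤ δ) {s : ℝ} (hs : 0 ≤ s)
    (hr : (1 + Real.sqrt δ) * (2 * m) ≤ r s ^ (n - 2)) :
    (1 - Real.sqrt δ) * schPotential n m (r s) ≤ q s ^ 2 := by
  have h1 := one_sub_sq_le hn hm ha h hs
  have h2 : (1 + Real.sqrt δ) * (2 * m / r s ^ (n - 2)) ≤ 1 := by
    rw [← mul_div_assoc, div_le_one (pow_pos (h.pos' hs) _)]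
    exact hr
  rw [schPotential]
  -- With `x = 2m/r^{n-2}` and `e = √δ`, one has `1 - (1+e²)x - (1-e)(1-x) = e(1 - (1+e)x)`, which
  -- is nonnegative exactly because of the assumed lower bound on the radius (when `e > 0`). This is
  -- where `r_δ` comes from.
  have h3 := mul_le_mul_of_nonneg_left h2 (Real.sqrt_nonneg δ)
  have h4 := Real.mul_self_sqrt hδ
  generalize 2 * m / r s ^ (n - 2) = x at *
  generalize Real.sqrt δ = e at *
  subst h4
  nlinarith

/-- The derivative of `schDistance ∘ r`. -/
theorem hasDerivAt_schDistance_comp (hn : 3 ≤ n) (hm : 0 < m) (ha : horizonRadius n m = r 0)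
    (h : RadiusProfile (n - 2) δ r q) {s : ℝ} (hs : 0 < s) :
    HasDerivAt (fun s => schDistance n m (r s))
      ((Real.sqrt (schPotential n m (r s)))⁻¹ * q s) s :=
  (hasDerivAt_schDistance hn hm (horizonRadius_lt ha h hs)).comp s (h.hasDerivAt s hs)

theorem continuousOn_schDistance_comp (hn : 3 ≤ n) (hm : 0 < m) (ha : horizonRadius n m = r 0)
    (h : RadiusProfile (n - 2) δ r q) :
    ContinuousOn (fun s => schDistance n m (r s)) (Ici 0) :=
  (continuousOn_schDistance hn hm).comp h.continuousOn
    fun _ hs => horizonRadius_le ha h hs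

/-- At equal radius `M` has at least the Hawking mass of Schwarzschild, so its radius grows no
faster, and passing to the Schwarzschild distance of the same radius does not stretch. -/
theorem deriv_comp_sq_le (hn : 3 ≤ n) (hm : 0 < m) (ha : horizonRadius n m = r 0)
    (h : RadiusProfile (n - 2) δ r q) {s : ℝ} (hs : 0 < s) :
    ((Real.sqrt (schPotential n m (r s)))⁻¹ * q s) ^ 2 ≤ 1 := by
  have hV := schPotential_pos hn hm (horizonRadius_lt ha h hs)
  rw [mul_pow, inv_pow, Real.sq_sqrt hV.le, inv_mul_le_iff₀ hV, mul_one]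
  exact sq_le_schPotential hn hm ha h hs.le

theorem deriv_comp_pos (hn : 3 ≤ n) (hm : 0 < m) (ha : horizonRadius n m = r 0)
    (h : RadiusProfile (n - 2) δ r q) {s : ℝ} (hs : 0 < s) :
    0 < (Real.sqrt (schPotential n m (r s)))⁻¹ * q s :=
  mul_pos (inv_pos.mpr (Real.sqrt_pos.mpr
    (schPotential_pos hn hm (horizonRadius_lt ha h hs)))) (h.deriv_pos s hs)

theorem le_deriv_comp_sq (hn : 3 ≤ n) (hm : 0 < m) (ha : horizonRadius n m = r 0)
    (h : RadiusProfile (n - 2) δ r q) (hδ : 0 ≤ δ) {s : ℝ} (hs : 0 < s)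
    (hr : (1 + Real.sqrt δ) * (2 * m) ≤ r s ^ (n - 2)) :
    1 - Real.sqrt δ ≤ ((Real.sqrt (schPotential n m (r s)))⁻¹ * q s) ^ 2 := by
  have hV := schPotential_pos hn hm (horizonRadius_lt ha h hs)
  rw [mul_pow, inv_pow, Real.sq_sqrt hV.le, le_inv_mul_iff₀ hV, mul_comm]
  exact mul_schPotential_le_sq hn hm ha h hδ hs.le hr

/-! ### Heights -/

theorem continuousOn_slope (h : RadiusProfile (n - 2) δ r q) :
    ContinuousOn (fun s => Real.sqrt (1 - q s ^ 2)) (Ici 0) :=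
  (continuousOn_const.sub (h.continuousOn_deriv.pow 2)).sqrt

end RadiusProfile

/-- The primitive of a function that is continuous on `[0, ∞)`. -/
theorem primitive_of_continuousOn {f : ℝ → ℝ} (hf : ContinuousOn f (Ici 0)) :
    (∀ s, 0 ≤ s → IntervalIntegrable f volume 0 s) ∧
    ContinuousOn (fun s => ∫ u in (0 : ℝ)..s, f u) (Ici 0) ∧
    ∀ s, 0 < s → HasDerivAt (fun s => ∫ u in (0 : ℝ)..s, f u) (f s) s := by
  have hint : ∀ s, 0 ≤ s → IntervalIntegrable f volume 0 s := fun s hs =>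
    (hf.mono (by rw [uIcc_of_le hs]; exact fun u hu => hu.1)).intervalIntegrable
  refine ⟨hint, fun s hs => ?_, fun s hs => ?_⟩
  · have hs : 0 ≤ s := hs
    have hle : 0 ≤ s + 1 := by linarith
    have h1 := intervalIntegral.continuousOn_primitive_interval' (hint _ hle) left_mem_uIcc
    rw [uIcc_of_le hle] at h1
    refine (h1 s ⟨hs, by linarith⟩).mono_of_mem_nhdsWithin ?_
    rw [← Ici_inter_Iic]
    exact inter_mem_nhdsWithin _ (Iic_mem_nhds (by linarith))
  · exact intervalIntegral.integral_hasDerivAt_right (hint s hs.le)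
      (hf.stronglyMeasurableAtFilter_nhdsWithin measurableSet_Ici s |>.filter_mono
        (by rw [nhdsWithin_eq_nhds.mpr (Ici_mem_nhds hs)]))
      (hf.continuousAt (Ici_mem_nhds hs))

/-- Bounds on a primitive from bounds on the integrand. -/
theorem primitive_bounds {f : ℝ → ℝ} (hf : ContinuousOn f (Ici 0)) {s a b : ℝ} (hs : 0 ≤ s)
    (h : ∀ u ∈ Icc 0 s, a ≤ f u ∧ f u ≤ b) :
    a * s ≤ ∫ u in (0 : ℝ)..s, f u ∧ ∫ u in (0 : ℝ)..s, f u ≤ b * s := by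
  have hint := (primitive_of_continuousOn hf).1 s hs
  have h1 := intervalIntegral.integral_mono_on hs intervalIntegrable_const hint
    fun u hu => (h u hu).1
  have h2 := intervalIntegral.integral_mono_on hs hint intervalIntegrable_const
    fun u hu => (h u hu).2
  rw [intervalIntegral.integral_const, smul_eq_mul, sub_zero] at h1 h2
  exact ⟨by linarith, by linarith⟩

/-- A slope `√x` is between `(√(1 + ε))⁻¹` and `1`. -/
theorem sqrt_mem_of_pow_le {c p e : ℝ} (hp : 0 < p) (he : 0 ≤ e)
    (h : p ≤ (1 + e) * c) : (Real.sqrt (1 + e))⁻¹ ≤ Real.sqrt (c / p) := by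
  rw [← Real.sqrt_inv]
  refine Real.sqrt_le_sqrt ?_
  rwa [inv_le_iff_one_le_mul₀ (by linarith), div_mul_eq_mul_div, one_le_div₀ hp, mul_comm c]

namespace RadiusProfile

variable {n : ℕ} {m δ : ℝ} {r : ℝ → ℝ}

/-- The height of the manifold above its boundary exceeds that of the Schwarzschild space, and both
are comparable to the lengths. -/
theorem height_comparison (hn : 3 ≤ n) (hm : 0 < m) (ha : horizonRadius n m = r 0)
    (h : RadiusProfile (n - 2) δ r (derivWithin r (Ici 0))) {s : ℝ} (hs : 0 ≤ s) :
    graphHeight (schRadius n m) (schDistance n m (r s)) ≤ graphHeight r s := by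
  obtain ⟨-, c1, d1⟩ := primitive_of_continuousOn h.continuousOn_slope
  obtain ⟨-, c2, d2⟩ := primitive_of_continuousOn (continuousOn_schSlope hn hm)
  have hnn : ∀ s, 0 ≤ s → 0 ≤ schDistance n m (r s) := fun s hs =>
    (bijOn_schDistance hn hm).mapsTo (horizonRadius_le ha h hs)
  have hpos : ∀ s, 0 < s → 0 < schDistance n m (r s) := fun s hs => by
    rw [← schDistance_horizonRadius (n := n) (m := m)]
    exact strictMonoOn_schDistance hn hm self_mem_Ici (horizonRadius_le ha h hs.le)
      (horizonRadius_lt ha h hs)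
  have hd : ∀ s, 0 < s → HasDerivAt (fun s => (∫ u in (0 : ℝ)..s,
      Real.sqrt (1 - derivWithin r (Ici 0) u ^ 2))
        - ∫ u in (0 : ℝ)..(schDistance n m (r s)), schSlope n m u) _ s := fun s hs =>
    (d1 s hs).sub (HasDerivAt.comp (h₂ := fun σ => ∫ u in (0 : ℝ)..σ, schSlope n m u) s
      (d2 _ (hpos s hs)) (hasDerivAt_schDistance_comp hn hm ha h hs))
  have hmono : MonotoneOn (fun s => (∫ u in (0 : ℝ)..s,
      Real.sqrt (1 - derivWithin r (Ici 0) u ^ 2))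
        - ∫ u in (0 : ℝ)..(schDistance n m (r s)), schSlope n m u) (Ici 0) := by
    refine monotoneOn_of_deriv_nonneg (convex_Ici 0)
      (c1.sub (c2.comp (continuousOn_schDistance_comp hn hm ha h) hnn)) ?_ ?_
    · intro s hs
      rw [interior_Ici] at hs
      exact (hd s hs).differentiableAt.differentiableWithinAt
    · intro s hs
      rw [interior_Ici] at hs
      have hs : 0 < s := hs
      rw [(hd s hs).deriv, schSlope, schRadius_schDistance hn hm (horizonRadius_le ha h hs.le)]
      -- The slope of `M` is at least the Schwarzschild slope at the same radius, and the
      -- Schwarzschild distance advances at rate at most `1`; both effects make the difference of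
      -- the heights increase.
      have h1 := Real.sqrt_le_sqrt (div_le_one_sub_sq hn hm ha h hs.le)
      have h2 := (sq_le_one_iff₀ (deriv_comp_pos hn hm ha h hs).le).mp
        (deriv_comp_sq_le hn hm ha h hs)
      have h3 := mul_le_of_le_one_right (Real.sqrt_nonneg (2 * m / r s ^ (n - 2))) h2
      linarith
  have := hmono self_mem_Ici hs hs
  simp only [intervalIntegral.integral_same, ← ha, schDistance_horizonRadius, sub_zero] at this
  rw [graphHeight_schRadius hn hm (hnn s hs), graphHeight]
  linarith

/-- As long as `2m ≤ r^{n-2} ≤ (1+e) 2m`, the slope in arc length is at least `(1+e)^{-1/2}`, and it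
never exceeds `1`. It is applied with `e = √δ`, up to radius `r_δ`. -/
theorem graphHeight_bounds (hn : 3 ≤ n) (hm : 0 < m) (ha : horizonRadius n m = r 0) {e : ℝ}
    (he : 0 ≤ e) (h : RadiusProfile (n - 2) δ r (derivWithin r (Ici 0))) {s : ℝ} (hs : 0 ≤ s)
    (hr : r s ^ (n - 2) = (1 + e) * (2 * m)) :
    (Real.sqrt (1 + e))⁻¹ * s ≤ graphHeight r s ∧ graphHeight r s ≤ s := by
  have := primitive_bounds h.continuousOn_slope (a := (Real.sqrt (1 + e))⁻¹) (b := 1) hs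
    fun u hu => ⟨?_, ?_⟩
  · rwa [one_mul] at this
  · refine (sqrt_mem_of_pow_le (pow_pos (h.pos' hu.1) (n - 2)) he ?_).trans
      (Real.sqrt_le_sqrt (div_le_one_sub_sq hn hm ha h hu.1))
    rw [← hr]
    exact pow_le_pow_left₀ (h.pos' hu.1).le (h.strictMonoOn.monotoneOn hu.1 hs hu.2) _
  · rw [Real.sqrt_le_one]
    linarith [sq_nonneg (derivWithin r (Ici 0) u)]

end RadiusProfile

/-- The same range of slopes, read off from the explicit Schwarzschild slope. -/
theorem graphHeight_schRadius_bounds {n : ℕ} {m e : ℝ} (hn : 3 ≤ n) (hm : 0 < m) (he : 0 ≤ e)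
    {σ : ℝ} (hσ : 0 ≤ σ) (hr : schRadius n m σ ^ (n - 2) = (1 + e) * (2 * m)) :
    (Real.sqrt (1 + e))⁻¹ * σ ≤ graphHeight (schRadius n m) σ ∧
      graphHeight (schRadius n m) σ ≤ σ := by
  have hge : ∀ u, 0 ≤ u → horizonRadius n m ≤ schRadius n m u :=
    fun u hu => horizonRadius_le_schRadius hn hm hu
  have hpos : ∀ u, 0 ≤ u → 0 < schRadius n m u := fun u hu =>
    (horizonRadius_pos hm).trans_le (hge u hu)
  rw [graphHeight_schRadius hn hm hσ]
  have := primitive_bounds (continuousOn_schSlope hn hm) (a := (Real.sqrt (1 + e))⁻¹) (b := 1) hσ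
    fun u hu => ⟨?_, ?_⟩
  · rwa [one_mul] at this
  · refine sqrt_mem_of_pow_le (pow_pos (hpos u hu.1) (n - 2)) he ?_
    rw [← hr]
    exact pow_le_pow_left₀ (hpos u hu.1).le
      ((strictMonoOn_schRadius hn hm).monotoneOn hu.1 hσ hu.2) _
  · rw [schSlope, Real.sqrt_le_one, div_le_one (pow_pos (hpos u hu.1) _),
      ← horizonRadius_pow hn hm]
    exact pow_le_pow_left₀ (horizonRadius_pos hm).le (hge u hu.1) _

end

section

/-! ### Radial maps -/

variable {n : ℕ}

/-- The tangential component of `v` at `x`, divided by `‖x‖`: the derivative of `x / ‖x‖` in the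
direction `v`. -/
def angular (x v : E n) : E n := ‖x‖⁻¹ • v - (⟪x, v⟫ / ‖x‖ ^ 3) • x

/-- Here `⟪x, v⟫ / ‖x‖` is `ds(v)` and `angular x v` is the velocity of the direction `x / ‖x‖`, so
this is `ds² + r² g₀` with the two components separated; metrics are compared term by term in this
form. -/
theorem warpedMetric_self (r : ℝ → ℝ) {x : E n} (hx : x ≠ 0) (v : E n) :
    warpedMetric r x v v
      = (⟪x, v⟫ / ‖x‖) ^ 2 + r (‖x‖ - 1) ^ 2 * ‖angular x v‖ ^ 2 := by
  have h0 := norm_ne_zero_iff.mpr hx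
  rw [angular, norm_sub_sq_real, norm_smul, norm_smul, inner_smul_left, inner_smul_right,
    real_inner_comm x v, warpedMetric, real_inner_self_eq_norm_sq]
  simp only [conj_trivial, mul_pow, Real.norm_eq_abs, sq_abs]
  field_simp
  ring

theorem warpedMetric_self_pos {r : ℝ → ℝ} {x : E n} (hx : x ≠ 0) (hr : r (‖x‖ - 1) ≠ 0) {v : E n}
    (hv : v ≠ 0) : 0 < warpedMetric r x v v := by
  rw [warpedMetric_self r hx]
  have h0 := norm_ne_zero_iff.mpr hx
  rcases eq_or_ne ⟪x, v⟫ 0 with h | h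
  · have : angular x v ≠ 0 := by
      rw [angular, h]
      simpa [hx] using hv
    have := norm_pos_iff.mpr this
    positivity
  · positivity

theorem hasDerivWithinAt_norm {c : ℝ → E n} {v : E n} {T : Set ℝ} {t : ℝ} (h0 : c t ≠ 0)
    (hc : HasDerivWithinAt c v T t) :
    HasDerivWithinAt (fun u => ‖c u‖) (⟪c t, v⟫ / ‖c t‖) T t := by
  refine ((hasFDerivAt_norm h0).comp_hasDerivWithinAt t hc).congr_deriv ?_
  simp [div_eq_inv_mul]

theorem hasDerivWithinAt_normalize {c : ℝ → E n} {v : E n} {T : Set ℝ} {t : ℝ} (h0 : c t ≠ 0)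
    (hc : HasDerivWithinAt c v T t) :
    HasDerivWithinAt (fun u => ‖c u‖⁻¹ • c u) (angular (c t) v) T t := by
  have h1 := norm_ne_zero_iff.mpr h0
  refine (((hasDerivWithinAt_norm h0 hc).inv h1).smul hc).congr_deriv ?_
  rw [angular, sub_eq_add_neg, ← neg_smul]
  congr 2
  field_simp

/-- The map `(s, θ) ↦ (ψ(s), θ)`. -/
def radialMap (ψ : ℝ → ℝ) (x : E n) : E n := (1 + ψ (‖x‖ - 1)) • (‖x‖⁻¹ • x)

theorem sub_one_nonneg {x : E n} (hx : x ∈ Ext n) : 0 ≤ ‖x‖ - 1 := sub_nonneg.mpr hx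

theorem Ext.ne_zero {x : E n} (hx : x ∈ Ext n) : x ≠ 0 := norm_pos_iff.mp (Ext.norm_pos hx)

theorem norm_normalize {x : E n} (hx : x ∈ Ext n) : ‖‖x‖⁻¹ • x‖ = 1 := by
  rw [norm_smul, norm_inv, norm_norm, inv_mul_cancel₀ (Ext.norm_pos hx).ne']

variable {ψ : ℝ → ℝ}

theorem norm_radialMap (hψ : MapsTo ψ (Ici 0) (Ici 0)) {x : E n} (hx : x ∈ Ext n) :
    ‖radialMap ψ x‖ = 1 + ψ (‖x‖ - 1) := by
  have h : 0 ≤ ψ (‖x‖ - 1) := hψ (sub_one_nonneg hx)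
  rw [radialMap, norm_smul, norm_normalize hx, mul_one, Real.norm_of_nonneg (by linarith)]

theorem mapsTo_radialMap (hψ : MapsTo ψ (Ici 0) (Ici 0)) :
    MapsTo (radialMap ψ) (Ext n) (Ext n) := fun x hx => by
  have h : 0 ≤ ψ (‖x‖ - 1) := hψ (sub_one_nonneg hx)
  show 1 ≤ ‖radialMap ψ x‖
  rw [norm_radialMap hψ hx]
  linarith

theorem normalize_radialMap (hψ : MapsTo ψ (Ici 0) (Ici 0)) {x : E n} (hx : x ∈ Ext n) :
    ‖radialMap ψ x‖⁻¹ • radialMap ψ x = ‖x‖⁻¹ • x := by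
  have h : 0 ≤ ψ (‖x‖ - 1) := hψ (sub_one_nonneg hx)
  rw [norm_radialMap hψ hx, radialMap, inv_smul_smul₀ (by linarith)]

theorem radialMap_radialMap (hψ : MapsTo ψ (Ici 0) (Ici 0)) {η : ℝ → ℝ}
    (hη : LeftInvOn η ψ (Ici 0)) {x : E n} (hx : x ∈ Ext n) :
    radialMap η (radialMap ψ x) = x := by
  rw [radialMap, normalize_radialMap hψ hx, norm_radialMap hψ hx, add_sub_cancel_left,
    hη (sub_one_nonneg hx), add_sub_cancel, smul_inv_smul₀ (Ext.norm_pos hx).ne']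

theorem image_radialMap_symSphere (hψ : MapsTo ψ (Ici 0) (Ici 0)) {s : ℝ} (hs : 0 ≤ s) :
    radialMap ψ '' symSphere n s = symSphere n (ψ s) := by
  have hψs : 0 ≤ ψ s := hψ hs
  ext y
  simp only [symSphere, mem_image, mem_sphere_iff_norm, sub_zero]
  constructor
  · rintro ⟨x, hx, rfl⟩
    rw [norm_radialMap hψ (show 1 ≤ ‖x‖ by linarith), hx, add_sub_cancel_left]
  · intro hy
    have hn : ‖((1 + s) / (1 + ψ s)) • y‖ = 1 + s := by
      rw [norm_smul, hy, Real.norm_of_nonneg (by positivity), div_mul_cancel₀ _ (by linarith)]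
    refine ⟨((1 + s) / (1 + ψ s)) • y, hn, ?_⟩
    rw [radialMap, hn, add_sub_cancel_left, smul_smul, smul_smul]
    convert one_smul ℝ y
    field_simp

/-- The first fundamental form of the image of a direction under a radial map. -/
theorem radialMap_pushforward (hψ : MapsTo ψ (Ici 0) (Ici 0)) {x v : E n} (hx : x ∈ Ext n)
    {D : ℝ} {S T : Set ℝ} (hD : HasDerivWithinAt ψ D S (‖x‖ - 1))
    (hST : ∀ᶠ t in 𝓝[T] (0 : ℝ), ‖x + t • v‖ - 1 ∈ S) (r : ℝ → ℝ) :
    ∃ w, HasDerivWithinAt (fun t : ℝ => radialMap ψ (x + t • v)) w T 0 ∧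
      warpedMetric r (radialMap ψ x) w w
        = D ^ 2 * (⟪x, v⟫ / ‖x‖) ^ 2 + r (ψ (‖x‖ - 1)) ^ 2 * ‖angular x v‖ ^ 2 := by
  have hx0 := Ext.ne_zero hx
  have hρ := Ext.norm_pos hx
  have hf : 0 ≤ ψ (‖x‖ - 1) := hψ (sub_one_nonneg hx)
  have hf0 : 1 + ψ (‖x‖ - 1) ≠ 0 := by linarith
  set f := 1 + ψ (‖x‖ - 1) with hfdef
  set p := ⟪x, v⟫ / ‖x‖ with hp
  -- `ψ` may be differentiable from one side only, so `t` is restricted to the times at which the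
  -- radius lies on that side `S`; by `hST` this loses nothing near `0`.
  set T' := T ∩ {t : ℝ | ‖x + t • v‖ - 1 ∈ S}
  have hT' : T' ∈ 𝓝[T] (0 : ℝ) := inter_mem self_mem_nhdsWithin hST
  have hc : HasDerivWithinAt (fun t : ℝ => x + t • v) v T' 0 := by
    have := ((hasDerivAt_id (0 : ℝ)).smul_const v).const_add x
    rw [one_smul] at this
    exact this.hasDerivWithinAt
  have e0 : x + (0 : ℝ) • v = x := by simp
  have h1 := hasDerivWithinAt_norm (by rwa [e0]) hc
  have h2 := hasDerivWithinAt_normalize (by rwa [e0]) hc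
  rw [e0] at h1 h2
  have h3 : HasDerivWithinAt (fun t : ℝ => 1 + ψ (‖x + t • v‖ - 1)) (D * p) T' 0 :=
    (HasDerivWithinAt.comp (h₂ := ψ) (h := fun t : ℝ => ‖x + t • v‖ - 1) (s' := S) 0
      (by simpa using hD) (h1.sub_const 1) (fun t ht => ht.2)).const_add 1
  have h4 : HasDerivWithinAt (fun t : ℝ => radialMap ψ (x + t • v)) _ T' 0 := h3.smul h2
  simp only [zero_smul, add_zero, ← hfdef] at h4
  refine ⟨_, h4.mono_of_mem_nhdsWithin hT', ?_⟩
  have hφ : radialMap ψ x ≠ 0 := Ext.ne_zero (mapsTo_radialMap hψ hx)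
  have hux : ⟪‖x‖⁻¹ • x, ‖x‖⁻¹ • x⟫ = 1 := by
    rw [real_inner_self_eq_norm_sq, norm_normalize hx, one_pow]
  have huτ : ⟪‖x‖⁻¹ • x, angular x v⟫ = 0 := by
    rw [angular, inner_sub_right, inner_smul_left, inner_smul_left, inner_smul_right,
      inner_smul_right, real_inner_self_eq_norm_sq, conj_trivial]
    field_simp
    ring
  have hin : ⟪radialMap ψ x, f • angular x v + (D * p) • ‖x‖⁻¹ • x⟫ = f * (D * p) := by
    rw [radialMap, inner_smul_left, inner_add_right, inner_smul_right, inner_smul_right, hux, huτ,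
      conj_trivial, ← hfdef]
    ring
  have hang : angular (radialMap ψ x) (f • angular x v + (D * p) • ‖x‖⁻¹ • x) = angular x v := by
    rw [angular, hin, norm_radialMap hψ hx, ← hfdef, radialMap, ← hfdef, smul_add, smul_smul f⁻¹ f,
      inv_mul_cancel₀ hf0, one_smul, smul_smul f⁻¹, smul_smul (f * (D * p) / f ^ 3) f]
    have : f * (D * p) / f ^ 3 * f = f⁻¹ * (D * p) := by field_simp
    rw [this, add_sub_cancel_right]
  rw [warpedMetric_self r hφ, hin, hang, norm_radialMap hψ hx, ← hfdef, hfdef, add_sub_cancel_left,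
    ← hfdef, mul_div_cancel_left₀ _ hf0]
  ring

theorem norm_add_smul_sq (x v : E n) (t : ℝ) :
    ‖x + t • v‖ ^ 2 = ‖x‖ ^ 2 + t * (2 * ⟪x, v⟫ + t * ‖v‖ ^ 2) := by
  rw [norm_add_sq_real, inner_smul_right, norm_smul, mul_pow, Real.norm_eq_abs, sq_abs]
  ring

/-- Ratio of the metric and its image under a radial map, in every direction. -/
theorem radialMap_pushforward_ratio (hψ : MapsTo ψ (Ici 0) (Ici 0)) {r r' : ℝ → ℝ} {h D D' : ℝ}
    {x v : E n} (hx : x ∈ Ext n) (hv : v ≠ 0) (hh : 0 < h)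
    (hr : 0 < r (‖x‖ - 1)) (hrr' : r (‖x‖ - 1) ^ 2 ≤ h * r' (ψ (‖x‖ - 1)) ^ 2)
    (hr'r : r' (ψ (‖x‖ - 1)) ^ 2 ≤ h * r (‖x‖ - 1) ^ 2)
    (hD : HasDerivWithinAt ψ D (Ici (‖x‖ - 1)) (‖x‖ - 1)) (h1 : D ^ 2 ≤ h) (h2 : 1 ≤ h * D ^ 2)
    (hD' : 0 < ‖x‖ - 1 → HasDerivWithinAt ψ D' (Iic (‖x‖ - 1)) (‖x‖ - 1) ∧
      D' ^ 2 ≤ h ∧ 1 ≤ h * D' ^ 2) :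
    ∃ w, IsPushforward (radialMap ψ) x v w ∧
      h⁻¹ ≤ warpedMetric r x v v / warpedMetric r' (radialMap ψ x) w w ∧
      warpedMetric r x v v / warpedMetric r' (radialMap ψ x) w w ≤ h := by
  have hx0 := Ext.ne_zero hx
  have hpos : 0 < warpedMetric r x v v := warpedMetric_self_pos hx0 hr.ne' hv
  have key : ∀ (D : ℝ) (w : E n), D ^ 2 ≤ h → 1 ≤ h * D ^ 2 →
      warpedMetric r' (radialMap ψ x) w w
        = D ^ 2 * (⟪x, v⟫ / ‖x‖) ^ 2 + r' (ψ (‖x‖ - 1)) ^ 2 * ‖angular x v‖ ^ 2 →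
      h⁻¹ ≤ warpedMetric r x v v / warpedMetric r' (radialMap ψ x) w w ∧
      warpedMetric r x v v / warpedMetric r' (radialMap ψ x) w w ≤ h := by
    intro D w h1 h2 hw
    have a1 := mul_le_mul_of_nonneg_right h1 (sq_nonneg (⟪x, v⟫ / ‖x‖))
    have a2 := mul_le_mul_of_nonneg_right h2 (sq_nonneg (⟪x, v⟫ / ‖x‖))
    have b1 := mul_le_mul_of_nonneg_right hrr' (sq_nonneg ‖angular x v‖)
    have b2 := mul_le_mul_of_nonneg_right hr'r (sq_nonneg ‖angular x v‖)
    have c1 : warpedMetric r' (radialMap ψ x) w w ≤ h * warpedMetric r x v v := by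
      rw [hw, warpedMetric_self r hx0]
      linarith
    have c2 : warpedMetric r x v v ≤ h * warpedMetric r' (radialMap ψ x) w w := by
      rw [hw, warpedMetric_self r hx0]
      linarith
    have hpos' : 0 < warpedMetric r' (radialMap ψ x) w w :=
      pos_of_mul_pos_right (hpos.trans_le c2) hh.le
    rw [le_div_iff₀ hpos', div_le_iff₀ hpos', inv_mul_le_iff₀ hh]
    exact ⟨c1, c2⟩
  -- The sign of `t (2⟪x, v⟫ + t ‖v‖²)` decides whether `x + t v` lies outside or inside the sphere
  -- through `x`, hence which one-sided derivative of `ψ` applies.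
  have hle : ∀ t : ℝ, 0 ≤ t * (2 * ⟪x, v⟫ + t * ‖v‖ ^ 2) → ‖x + t • v‖ - 1 ∈ Ici (‖x‖ - 1) := by
    intro t ht
    refine sub_le_sub_right ((sq_le_sq₀ (norm_nonneg _) (norm_nonneg _)).mp ?_) 1
    rw [norm_add_smul_sq]
    linarith
  -- A tangential `v` belongs with the outward ones: the radius along the line grows quadratically,
  -- so the right derivative `D` governs it.
  rcases le_or_gt 0 ⟪x, v⟫ with hin | hin
  · have hev : ∀ᶠ t in 𝓝[Ici 0] (0 : ℝ), ‖x + t • v‖ - 1 ∈ Ici (‖x‖ - 1) := by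
      refine eventually_nhdsWithin_of_forall fun t ht => hle t ?_
      have : 0 ≤ t := ht
      positivity
    obtain ⟨w, hw, hw'⟩ := radialMap_pushforward hψ hx hD hev r'
    exact ⟨w, Or.inl ⟨Or.inr hin, hw⟩, key D w h1 h2 hw'⟩
  · rcases (show 1 ≤ ‖x‖ from hx).eq_or_lt with h1x | h1x
    -- At the boundary, a vector leaving the manifold is followed backwards in time; the radius then
    -- increases, so `D` applies again.
    · have hev : ∀ᶠ t in 𝓝[Iic 0] (0 : ℝ), ‖x + t • v‖ - 1 ∈ Ici (‖x‖ - 1) := by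
        refine eventually_nhdsWithin_of_forall fun t ht => hle t ?_
        have : t ≤ 0 := ht
        refine mul_nonneg_of_nonpos_of_nonpos this ?_
        linarith [mul_nonpos_of_nonpos_of_nonneg this (sq_nonneg ‖v‖)]
      obtain ⟨w, hw, hw'⟩ := radialMap_pushforward hψ hx hD hev r'
      exact ⟨w, Or.inr ⟨h1x.symm, hin, hw⟩, key D w h1 h2 hw'⟩
    · obtain ⟨hD', h1', h2'⟩ := hD' (sub_pos.mpr h1x)
      have hev : ∀ᶠ t in 𝓝[Ici 0] (0 : ℝ), ‖x + t • v‖ - 1 ∈ Iic (‖x‖ - 1) := by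
        have hlim : Tendsto (fun t : ℝ => 2 * ⟪x, v⟫ + t * ‖v‖ ^ 2) (𝓝[Ici 0] 0)
            (𝓝 (2 * ⟪x, v⟫ + 0 * ‖v‖ ^ 2)) :=
          (tendsto_const_nhds.add (tendsto_id.mul_const _)).mono_left nhdsWithin_le_nhds
        filter_upwards [hlim.eventually_lt_const (by linarith : 2 * ⟪x, v⟫ + 0 * ‖v‖ ^ 2 < 0),
          self_mem_nhdsWithin] with t ht ht0
        refine sub_le_sub_right ((sq_le_sq₀ (norm_nonneg _) (norm_nonneg _)).mp ?_) 1
        rw [norm_add_smul_sq]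
        linarith [mul_nonpos_of_nonneg_of_nonpos (show 0 ≤ t from ht0) ht.le]
      obtain ⟨w, hw, hw'⟩ := radialMap_pushforward hψ hx hD' hev r'
      exact ⟨w, Or.inl ⟨Or.inl h1x, hw⟩, key D' w h1' h2' hw'⟩

theorem differentiableWithinAt_radialMap {x : E n} (hx : x ∈ Ext n)
    (h : DifferentiableWithinAt ℝ ψ (Ici 0) (‖x‖ - 1)) :
    DifferentiableWithinAt ℝ (radialMap ψ) (Ext n) x := by
  have hx0 := Ext.ne_zero hx
  have h1 : DifferentiableWithinAt ℝ (fun y : E n => ‖y‖) (Ext n) x :=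
    (hasFDerivAt_norm hx0).differentiableAt.differentiableWithinAt
  have h2 : DifferentiableWithinAt ℝ (fun y : E n => ψ (‖y‖ - 1)) (Ext n) x :=
    DifferentiableWithinAt.comp (g := ψ) (f := fun y : E n => ‖y‖ - 1) x h (h1.sub_const 1)
      fun y hy => sub_one_nonneg hy
  exact (h2.const_add 1).smul
    ((h1.inv (Ext.norm_pos hx).ne').smul differentiableWithinAt_id)

theorem norm_toEuclideanLin {Q : Matrix (Fin n) (Fin n) ℝ}
    (hQ : Q ∈ Matrix.specialOrthogonalGroup (Fin n) ℝ) (x : E n) :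
    ‖Matrix.toEuclideanLin Q x‖ = ‖x‖ := by
  have h1 : Q.conjTranspose * Q = 1 :=
    (Matrix.mem_orthogonalGroup_iff' (Fin n) ℝ).mp (Matrix.mem_specialOrthogonalGroup_iff.mp hQ).1
  have h2 : LinearMap.adjoint (Matrix.toEuclideanLin Q) (Matrix.toEuclideanLin Q x) = x := by
    rw [← Matrix.toEuclideanLin_conjTranspose_eq_adjoint]
    simp only [Matrix.toLpLin_apply, Matrix.mulVec_mulVec, h1, Matrix.one_mulVec]
  rw [← sq_eq_sq₀ (norm_nonneg _) (norm_nonneg _), ← real_inner_self_eq_norm_sq,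
    ← LinearMap.adjoint_inner_right, h2, real_inner_self_eq_norm_sq]

theorem isRotEquivariant_radialMap : IsRotEquivariant (radialMap (n := n) ψ) := fun Q hQ x _ => by
  rw [radialMap, radialMap, norm_toEuclideanLin hQ, map_smul, map_smul]

end

section

/-! ### Bi-Lipschitz radial maps -/

variable {n : ℕ} {ψ : ℝ → ℝ}

/-- Derivatives inherit comparison of increments. -/
theorem abs_deriv_le_of_abs_sub_le {f g : ℝ → ℝ} {a b K t : ℝ} (hf : HasDerivAt f a t)
    (hg : HasDerivAt g b t) (h : ∀ᶠ u in 𝓝 t, |g u - g t| ≤ K * |f u - f t|) : |b| ≤ K * |a| := by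
  refine le_of_tendsto_of_tendsto (b := 𝓝[≠] t) (hasDerivAt_iff_tendsto_slope.mp hg).abs
    ((hasDerivAt_iff_tendsto_slope.mp hf).abs.const_mul K) ?_
  filter_upwards [h.filter_mono nhdsWithin_le_nhds] with u hu
  rw [slope_def_field, slope_def_field, abs_div, abs_div, ← mul_div_assoc]
  exact div_le_div_of_nonneg_right hu (abs_nonneg _)

theorem dist_normalize_le {x y : E n} (hx : x ∈ Ext n) (hy : y ∈ Ext n) :
    ‖x‖ * ‖‖x‖⁻¹ • x - ‖y‖⁻¹ • y‖ ≤ 2 * ‖x - y‖ := by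
  have h0 := (Ext.norm_pos hx).ne'
  have h0' := (Ext.norm_pos hy).ne'
  have e : ‖x‖ * ‖‖x‖⁻¹ • x - ‖y‖⁻¹ • y‖ = ‖(x - y) + (‖y‖ - ‖x‖) • (‖y‖⁻¹ • y)‖ := by
    rw [← norm_smul_of_nonneg (norm_nonneg x), smul_sub, smul_inv_smul₀ h0, sub_smul,
      smul_inv_smul₀ h0']
    congr 1
    abel
  rw [e]
  refine (norm_add_le _ _).trans ?_
  rw [norm_smul, norm_normalize hy, mul_one, Real.norm_eq_abs]
  have := abs_norm_sub_norm_le y x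
  rw [norm_sub_rev] at this
  linarith

/-- Needed so that the image of an admissible curve is admissible. The factor `1 + ψ` grows at most
linearly in `‖x‖`, while directions vary by at most `2‖x - y‖ / ‖x‖`; this produces the second
summand of the constant, the first being the radial part. -/
theorem lipschitzOnWith_radialMap (hψ : MapsTo ψ (Ici 0) (Ici 0)) {K : ℝ≥0}
    (hK : ∀ s, 0 ≤ s → ∀ s', 0 ≤ s' → |ψ s - ψ s'| ≤ K * |s - s'|) :
    ∃ C : ℝ≥0, LipschitzOnWith C (radialMap ψ) (Ext n) := by
  have h00 : 0 ≤ ψ 0 := hψ self_mem_Ici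
  refine ⟨K + 2 * (1 + K + ⟨ψ 0, h00⟩), LipschitzOnWith.of_dist_le_mul fun x hx y hy => ?_⟩
  have hxs := sub_one_nonneg hx
  have h0 := Ext.norm_pos hx
  have hfx : 0 ≤ ψ (‖x‖ - 1) := hψ hxs
  have h1 := hK _ hxs _ (sub_one_nonneg hy)
  have h2 := hK _ hxs 0 le_rfl
  rw [sub_zero, abs_of_nonneg hxs] at h2
  have h3 : 1 + ψ (‖x‖ - 1) ≤ (1 + K + ψ 0) * ‖x‖ := by
    have h4 := (abs_le.mp h2).2
    have h5 : 1 ≤ ‖x‖ := hx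
    have h6 := mul_le_mul_of_nonneg_left h5 h00
    have h7 : (0 : ℝ) ≤ K := K.coe_nonneg
    linarith
  have e : radialMap ψ x - radialMap ψ y = (1 + ψ (‖x‖ - 1)) • (‖x‖⁻¹ • x - ‖y‖⁻¹ • y)
      + (ψ (‖x‖ - 1) - ψ (‖y‖ - 1)) • (‖y‖⁻¹ • y) := by
    rw [radialMap, radialMap]
    module
  rw [dist_eq_norm, dist_eq_norm, e]
  refine (norm_add_le _ _).trans ?_
  rw [norm_smul, norm_smul, norm_normalize hy, mul_one, Real.norm_of_nonneg (by linarith),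
    Real.norm_eq_abs]
  have h8 := mul_le_mul_of_nonneg_right h3 (norm_nonneg (‖x‖⁻¹ • x - ‖y‖⁻¹ • y))
  have h9 := mul_le_mul_of_nonneg_left (dist_normalize_le hx hy)
    (by positivity : 0 ≤ 1 + (K : ℝ) + ψ 0)
  have h10 : (K : ℝ) * |‖x‖ - 1 - (‖y‖ - 1)| ≤ K * ‖x - y‖ := by
    rw [sub_sub_sub_cancel_right]
    exact mul_le_mul_of_nonneg_left (abs_norm_sub_norm_le x y) K.coe_nonneg
  push_cast
  show _ ≤ ((K : ℝ) + 2 * (1 + K + ψ 0)) * ‖x - y‖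
  linarith

/-- A radial map stretches velocities at most by the Lipschitz constants of its components. -/
theorem warpedMetric_radialMap_le (hψ : MapsTo ψ (Ici 0) (Ici 0)) {K : ℝ≥0} {r r' : ℝ → ℝ}
    (hK : ∀ s, 0 ≤ s → ∀ s', 0 ≤ s' → |ψ s - ψ s'| ≤ K * |s - s'|)
    (hr : ∀ s, 0 ≤ s → |r' (ψ s)| ≤ K * |r s|) {γ : ℝ → E n} {t : ℝ} {v w : E n}
    (hγ : ∀ᶠ u in 𝓝 t, γ u ∈ Ext n) (hv : HasDerivAt γ v t)
    (hw : HasDerivAt (fun u => radialMap ψ (γ u)) w t) :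
    warpedMetric r' (radialMap ψ (γ t)) w w ≤ K ^ 2 * warpedMetric r (γ t) v v := by
  have hx : γ t ∈ Ext n := hγ.self_of_nhds
  have hx0 := Ext.ne_zero hx
  have hφx := mapsTo_radialMap hψ hx
  have hφ0 := Ext.ne_zero hφx
  rw [warpedMetric_self r hx0, warpedMetric_self r' hφ0, norm_radialMap hψ hx, add_sub_cancel_left,
    ← norm_radialMap hψ hx]
  have n1 := (hasDerivWithinAt_norm hx0 hv.hasDerivWithinAt (T := univ)).hasDerivAt univ_mem
  have n2 := (hasDerivWithinAt_norm (c := fun u => radialMap ψ (γ u)) hφ0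
    hw.hasDerivWithinAt (T := univ)).hasDerivAt univ_mem
  have a1 := (hasDerivWithinAt_normalize hx0 hv.hasDerivWithinAt (T := univ)).hasDerivAt univ_mem
  have a2 := (hasDerivWithinAt_normalize (c := fun u => radialMap ψ (γ u)) hφ0
    hw.hasDerivWithinAt (T := univ)).hasDerivAt univ_mem
  -- The map preserves directions, so the two angular velocities coincide.
  have hang : angular (radialMap ψ (γ t)) w = angular (γ t) v :=
    a2.unique (a1.congr_of_eventuallyEq (hγ.mono fun u hu => normalize_radialMap hψ hu))
  -- No chain rule is available, since `ψ` may fail to be differentiable at this radius; the bound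
  -- on increments passes to the radial velocities instead.
  have hrad := abs_deriv_le_of_abs_sub_le n1 n2 (K := K) (hγ.mono fun u hu => by
    rw [norm_radialMap hψ hu, norm_radialMap hψ hx, add_sub_add_left_eq_sub]
    refine (hK _ (sub_one_nonneg hu) _ (sub_one_nonneg hx)).trans ?_
    rw [sub_sub_sub_cancel_right])
  rw [hang]
  have h1 := pow_le_pow_left₀ (abs_nonneg _) hrad 2
  have h2 := pow_le_pow_left₀ (abs_nonneg _) (hr _ (sub_one_nonneg hx)) 2
  rw [mul_pow, sq_abs, sq_abs] at h1 h2
  have h3 := mul_le_mul_of_nonneg_right h2 (sq_nonneg ‖angular (γ t) v‖)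
  linarith

/-- Every Lipschitz curve is pushed forward, and its speed grows by at most `K` at almost every
time, namely where both curves are differentiable. The condition `K ≠ 0` allows `K` to be moved
inside the infimum in `ℝ≥0∞`. -/
theorem riemDist_radialMap_le (hψ : MapsTo ψ (Ici 0) (Ici 0)) {K : ℝ≥0} (hK0 : K ≠ 0)
    {r r' : ℝ → ℝ} (hK : ∀ s, 0 ≤ s → ∀ s', 0 ≤ s' → |ψ s - ψ s'| ≤ K * |s - s'|)
    (hr : ∀ s, 0 ≤ s → |r' (ψ s)| ≤ K * |r s|) (x y : E n) :
    riemDist (warpedMetric r') (radialMap ψ x) (radialMap ψ y)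
      ≤ K * riemDist (warpedMetric r) x y := by
  obtain ⟨C, hC⟩ := lipschitzOnWith_radialMap (n := n) hψ hK
  rw [riemDist, riemDist, ENNReal.mul_iInf_of_ne (by simpa using hK0) ENNReal.coe_ne_top]
  refine le_iInf fun γ => ?_
  obtain ⟨γ, ⟨L, hL⟩, hmaps, h0, h1⟩ := γ
  have hLφ : LipschitzOnWith (C * L) (fun u => radialMap ψ (γ u)) (Icc 0 1) :=
    hC.comp hL hmaps
  refine (iInf_le _ ⟨fun u => radialMap ψ (γ u), ⟨_, hLφ⟩,
    fun u hu => mapsTo_radialMap hψ (hmaps hu), congrArg (radialMap ψ) h0,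
    congrArg (radialMap ψ) h1⟩).trans ?_
  -- Dropping the endpoints makes each remaining time interior, so differentiability within the
  -- interval is differentiability.
  rw [← lintegral_const_mul' _ _ ENNReal.coe_ne_top, restrict_Ioo_eq_restrict_Icc.symm]
  refine lintegral_mono_ae ((ae_restrict_iff' measurableSet_Ioo).mpr ?_)
  filter_upwards [hL.ae_differentiableWithinAt_of_mem_real,
    hLφ.ae_differentiableWithinAt_of_mem_real] with t d1 d2 ht
  have hmem := Icc_mem_nhds ht.1 ht.2
  have htI := Ioo_subset_Icc_self ht
  have key := warpedMetric_radialMap_le hψ hK hr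
    (eventually_of_mem hmem fun u hu => hmaps hu) ((d1 htI).differentiableAt hmem).hasDerivAt
    ((d2 htI).differentiableAt hmem).hasDerivAt
  have h2 := Real.sqrt_le_sqrt key
  rw [Real.sqrt_mul (sq_nonneg _), Real.sqrt_sq K.coe_nonneg] at h2
  calc _ ≤ ENNReal.ofReal (K * Real.sqrt (warpedMetric r (γ t) (deriv γ t) (deriv γ t))) :=
        ENNReal.ofReal_le_ofReal h2
    _ = _ := by rw [ENNReal.ofReal_mul K.coe_nonneg, ENNReal.ofReal_coe_nnreal]

/-- The distance estimate is applied to `ψ` and to its inverse on `[0, ∞)`, whose radial map inverts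
that of `ψ`. -/
theorem isBiLipschitz_radialMap (hψ : BijOn ψ (Ici 0) (Ici 0)) {K : ℝ≥0} (hK0 : K ≠ 0)
    {r r' : ℝ → ℝ} (hK : ∀ s, 0 ≤ s → ∀ s', 0 ≤ s' → |ψ s - ψ s'| ≤ K * |s - s'|)
    (hK' : ∀ s, 0 ≤ s → ∀ s', 0 ≤ s' → |s - s'| ≤ K * |ψ s - ψ s'|)
    (hr : ∀ s, 0 ≤ s → |r' (ψ s)| ≤ K * |r s|) (hr' : ∀ s, 0 ≤ s → |r s| ≤ K * |r' (ψ s)|) :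
    IsBiLipschitz (n := n) (warpedMetric r) (warpedMetric r') (radialMap ψ) := by
  have hinv := hψ.invOn_invFunOn
  set η := Function.invFunOn ψ (Ici 0)
  have hη : MapsTo η (Ici 0) (Ici 0) := hψ.surjOn.mapsTo_invFunOn
  have e1 : ∀ x ∈ Ext n, radialMap η (radialMap ψ x) = x := fun x hx =>
    radialMap_radialMap hψ.mapsTo hinv.1 hx
  refine ⟨InvOn.bijOn (f' := radialMap η) ⟨e1, fun x hx => radialMap_radialMap hη hinv.2 hx⟩
    (mapsTo_radialMap hψ.mapsTo) (mapsTo_radialMap hη), K, fun x hx y hy =>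
    ⟨riemDist_radialMap_le hψ.mapsTo hK0 hK hr x y, ?_⟩⟩
  have h := riemDist_radialMap_le hη hK0 (r := r') (r' := r) (fun s hs s' hs' => ?_)
    (fun s hs => ?_) (radialMap ψ x) (radialMap ψ y)
  · rwa [e1 x hx, e1 y hy] at h
  · have := hK' _ (hη hs) _ (hη hs')
    rwa [hinv.2 hs, hinv.2 hs'] at this
  · have := hr' _ (hη hs)
    rwa [hinv.2 hs] at this

end

section

/-! ### Gluing a linear function to a function with bounded derivative -/

/-- The lower slope `a > 0` gives injectivity and forces `ψ` to infinity, the upper slope gives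
continuity, and the intermediate value theorem does the rest. -/
theorem bijOn_of_increment_bounds {ψ : ℝ → ℝ} {a b : ℝ} (ha : 0 < a) (h0 : ψ 0 = 0)
    (h : ∀ s, 0 ≤ s → ∀ s', s ≤ s' → a * (s' - s) ≤ ψ s' - ψ s ∧ ψ s' - ψ s ≤ b * (s' - s)) :
    BijOn ψ (Ici 0) (Ici 0) ∧ (∀ s, 0 ≤ s → ∀ s', 0 ≤ s' → |ψ s - ψ s'| ≤ b * |s - s'|) ∧
      ∀ s, 0 ≤ s → ∀ s', 0 ≤ s' → a * |s - s'| ≤ |ψ s - ψ s'| := by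
  have key : ∀ s, 0 ≤ s → ∀ s', s ≤ s' →
      |ψ s - ψ s'| ≤ b * |s - s'| ∧ a * |s - s'| ≤ |ψ s - ψ s'| := by
    intro s hs s' hss'
    obtain ⟨h1, h2⟩ := h s hs s' hss'
    have h3 : 0 ≤ a * (s' - s) := mul_nonneg ha.le (sub_nonneg.mpr hss')
    rw [abs_sub_comm, abs_sub_comm s s', abs_of_nonneg (h3.trans h1),
      abs_of_nonneg (sub_nonneg.mpr hss')]
    exact ⟨h2, h1⟩
  have key' : ∀ s, 0 ≤ s → ∀ s', 0 ≤ s' →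
      |ψ s - ψ s'| ≤ b * |s - s'| ∧ a * |s - s'| ≤ |ψ s - ψ s'| := by
    intro s hs s' hs'
    rcases le_total s s' with hss' | hss'
    · exact key s hs s' hss'
    · rw [abs_sub_comm, abs_sub_comm s s']
      exact key s' hs' s hss'
  have hlow : ∀ s, 0 ≤ s → a * s ≤ ψ s := fun s hs => by
    have := (h 0 le_rfl s hs).1
    rwa [h0, sub_zero, sub_zero] at this
  have hb : 0 ≤ b := by
    have := h 0 le_rfl 1 zero_le_one
    linarith
  have hcont : ContinuousOn ψ (Ici 0) := by
    refine LipschitzOnWith.continuousOn (K := ⟨b, hb⟩) (LipschitzOnWith.of_dist_le_mul ?_)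
    intro s hs s' hs'
    exact (key' s hs s' hs').1
  refine ⟨⟨fun s hs => ?_, fun s hs s' hs' heq => ?_, fun t ht => ?_⟩,
    fun s hs s' hs' => (key' s hs s' hs').1, fun s hs s' hs' => (key' s hs s' hs').2⟩
  · exact (mul_nonneg ha.le hs).trans (hlow s hs)
  · have h1 := (key' s hs s' hs').2
    rw [heq, sub_self, abs_zero] at h1
    have h2 := nonpos_of_mul_nonpos_right h1 ha
    exact sub_eq_zero.mp (abs_eq_zero.mp (le_antisymm h2 (abs_nonneg _)))
  · have ht : 0 ≤ t := ht
    have hta : 0 ≤ t / a := div_nonneg ht ha.le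
    have h1 := hlow _ hta
    rw [mul_div_cancel₀ _ ha.ne'] at h1
    obtain ⟨s, hs, rfl⟩ := intermediate_value_Icc hta (hcont.mono fun u hu => hu.1)
      ⟨by rwa [h0], h1⟩
    exact ⟨s, hs.1, rfl⟩

/-- The function equal to `c s` for `s ≤ s₀` and to `g s` for `s > s₀`. -/
def glue (s₀ c : ℝ) (g : ℝ → ℝ) (s : ℝ) : ℝ := if s ≤ s₀ then c * s else g s

section

variable {s₀ c : ℝ} {g g' : ℝ → ℝ}

theorem glue_of_le {s : ℝ} (hs : s ≤ s₀) : glue s₀ c g s = c * s := if_pos hs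

theorem glue_of_ge (hg : g s₀ = c * s₀) {s : ℝ} (hs : s₀ ≤ s) : glue s₀ c g s = g s := by
  rcases hs.eq_or_lt with rfl | h
  · rw [glue_of_le le_rfl, hg]
  · exact if_neg (not_le.mpr h)

theorem hasDerivWithinAt_glue_Iic {s : ℝ} (hs : s ≤ s₀) :
    HasDerivWithinAt (glue s₀ c g) c (Iic s) s := by
  have h : HasDerivWithinAt (fun t => c * t) c (Iic s) s := by
    simpa using ((hasDerivAt_id s).const_mul c).hasDerivWithinAt
  exact h.congr (fun t ht => glue_of_le (le_trans ht hs)) (glue_of_le hs)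

theorem hasDerivAt_glue_of_lt {s : ℝ} (hs : s < s₀) : HasDerivAt (glue s₀ c g) c s := by
  have h : HasDerivAt (fun t => c * t) c s := by
    simpa using (hasDerivAt_id s).const_mul c
  exact h.congr_of_eventuallyEq ((eventually_lt_nhds hs).mono fun t ht => glue_of_le ht.le)

theorem hasDerivAt_glue_of_gt (hg : g s₀ = c * s₀) {s D : ℝ} (hs : s₀ < s)
    (h : HasDerivAt g D s) : HasDerivAt (glue s₀ c g) D s :=
  h.congr_of_eventuallyEq ((eventually_gt_nhds hs).mono fun _ ht => glue_of_ge hg (le_of_lt ht))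

theorem hasDerivWithinAt_glue_Ici (hg : g s₀ = c * s₀) {s D : ℝ} (hs : s₀ ≤ s)
    (h : HasDerivWithinAt g D (Ici s) s) : HasDerivWithinAt (glue s₀ c g) D (Ici s) s :=
  h.congr (fun _ ht => glue_of_ge hg (hs.trans ht)) (glue_of_ge hg hs)

/-- The claim says that `ψ(t) - a t` and `b t - ψ(t)` are monotone. This is checked on the two
pieces separately and joined at `s₀`, so nothing is differentiated at the corner. -/
theorem glue_increment_bounds (hg : g s₀ = c * s₀) (hs₀ : 0 ≤ s₀) (hgc : ContinuousOn g (Ici s₀))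
    (hgd : ∀ s, s₀ < s → HasDerivAt g (g' s) s) {a b : ℝ} (hac : a ≤ c) (hcb : c ≤ b)
    (hag : ∀ s, s₀ < s → a ≤ g' s) (hgb : ∀ s, s₀ < s → g' s ≤ b) {s s' : ℝ} (hs : 0 ≤ s)
    (hss' : s ≤ s') : a * (s' - s) ≤ glue s₀ c g s' - glue s₀ c g s ∧
      glue s₀ c g s' - glue s₀ c g s ≤ b * (s' - s) := by
  have hun : Icc 0 s₀ ∪ Ici s₀ = Ici (0 : ℝ) := Icc_union_Ici_eq_Ici hs₀
  have hmono : ∀ F : ℝ → ℝ → ℝ, (∀ t t', t ∈ Icc 0 s₀ → t' ∈ Icc 0 s₀ → t ≤ t' →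
        F t (c * t) ≤ F t' (c * t')) →
      MonotoneOn (fun t => F t (g t)) (Ici s₀) →
      MonotoneOn (fun t => F t (glue s₀ c g t)) (Ici 0) := by
    intro F h1 h2
    rw [← hun]
    refine MonotoneOn.union_right (c := s₀) (fun t ht t' ht' h => ?_) (fun t ht t' ht' h => ?_)
      ⟨⟨hs₀, le_rfl⟩, fun t ht => ht.2⟩ isLeast_Ici
    · simp only [glue_of_le ht.2, glue_of_le ht'.2]
      exact h1 t t' ht ht' h
    · simp only [glue_of_ge hg ht, glue_of_ge hg ht']
      exact h2 ht ht' h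
  have m1 := hmono (fun t y => y - a * t)
    (fun t t' _ _ h => by nlinarith) (by
      have hd : ∀ t, s₀ < t → HasDerivAt (fun t => g t - a * t) (g' t - a * 1) t := fun t ht =>
        (hgd t ht).sub ((hasDerivAt_id t).const_mul a)
      refine monotoneOn_of_deriv_nonneg (convex_Ici _)
        (hgc.sub (continuousOn_const.mul continuousOn_id)) ?_ ?_
      · intro t ht
        rw [interior_Ici] at ht
        exact (hd t ht).differentiableAt.differentiableWithinAt
      · intro t ht
        rw [interior_Ici] at ht
        rw [(hd t ht).deriv]
        linarith [hag t ht])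
  have m2 := hmono (fun t y => b * t - y)
    (fun t t' _ _ h => by nlinarith) (by
      have hd : ∀ t, s₀ < t → HasDerivAt (fun t => b * t - g t) (b * 1 - g' t) t := fun t ht =>
        ((hasDerivAt_id t).const_mul b).sub (hgd t ht)
      refine monotoneOn_of_deriv_nonneg (convex_Ici _)
        ((continuousOn_const.mul continuousOn_id).sub hgc) ?_ ?_
      · intro t ht
        rw [interior_Ici] at ht
        exact (hd t ht).differentiableAt.differentiableWithinAt
      · intro t ht
        rw [interior_Ici] at ht
        rw [(hd t ht).deriv]
        linarith [hgb t ht])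
  have h1 := m1 hs (hs.trans hss') hss'
  have h2 := m2 hs (hs.trans hss') hss'
  simp only at h1 h2
  constructor <;> linarith

end

/-! ### The parameters of the comparison -/

section

variable {n : ℕ} {r : ℝ → ℝ}

theorem RotSym.two_mul_boundaryMass (hn : 3 ≤ n) (hM : RotSym n r) :
    2 * boundaryMass n r = r 0 ^ (n - 2) := by
  rw [boundaryMass, hM.sphereArea_div hn]
  ring

theorem RotSym.boundaryMass_pos (hn : 3 ≤ n) (hM : RotSym n r) : 0 < boundaryMass n r := by
  have := hM.two_mul_boundaryMass hn
  have h2 := pow_pos (hM.pos 0 le_rfl) (n - 2)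
  linarith

theorem RotSym.horizonRadius_boundaryMass (hn : 3 ≤ n) (hM : RotSym n r) :
    horizonRadius n (boundaryMass n r) = r 0 := by
  have hm := hM.boundaryMass_pos hn
  refine (pow_left_inj₀ (horizonRadius_pos hm).le (hM.pos 0 le_rfl).le
    (by omega : n - 2 ≠ 0)).mp ?_
  rw [horizonRadius_pow hn hm, hM.two_mul_boundaryMass hn]

theorem radiusDelta_pow (hn : 3 ≤ n) (δ : ℝ) :
    radiusDelta n r δ ^ (n - 2) = (1 + Real.sqrt δ) * r 0 ^ (n - 2) := by
  have hn' : (3 : ℝ) ≤ n := by exact_mod_cast hn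
  have he : 0 ≤ 1 + Real.sqrt δ := by positivity
  rw [radiusDelta, mul_pow, ← Real.rpow_natCast (_ ^ _), ← Real.rpow_mul he,
    Nat.cast_sub (by omega)]
  push_cast
  rw [one_div_mul_cancel (by linarith), Real.rpow_one]

theorem areaDelta_eq (hn : 3 ≤ n) (δ : ℝ) :
    areaDelta n r δ = unitSphereArea n * radiusDelta n r δ ^ (n - 1) := by
  have he : 0 ≤ 1 + Real.sqrt δ := by positivity
  rw [areaDelta, radiusDelta, sphereArea, mul_pow, ← Real.rpow_natCast (_ ^ _), ← Real.rpow_mul he,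
    Nat.cast_sub (by omega)]
  push_cast
  rw [div_mul_eq_mul_div, one_mul]
  ring

theorem le_radiusDelta (hn : 3 ≤ n) (hr : 0 < r 0) (δ : ℝ) : r 0 ≤ radiusDelta n r δ := by
  have hn' : (3 : ℝ) ≤ n := by exact_mod_cast hn
  refine le_mul_of_one_le_left hr.le (Real.one_le_rpow ?_ ?_)
  · linarith [Real.sqrt_nonneg δ]
  · exact div_nonneg zero_le_one (by linarith)

theorem radiusDelta_div_sq (hr : 0 < r 0) (δ : ℝ) :
    (radiusDelta n r δ / r 0) ^ 2 = (1 + Real.sqrt δ) ^ (2 / ((n : ℝ) - 2)) := by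
  have he : 0 ≤ 1 + Real.sqrt δ := by positivity
  rw [radiusDelta, mul_div_cancel_right₀ _ hr.ne', ← Real.rpow_natCast, ← Real.rpow_mul he]
  congr 1
  push_cast
  ring

end

end

section

/-! ### Lengths below the sphere of radius `r_δ` -/

/-- The ratio `c` of the lengths of the two regions below the sphere of radius `r_δ`. -/
theorem exists_stretch {e s σ L zM zS : ℝ} (he : 0 ≤ e) (hs : 0 ≤ s) (hσ : 0 ≤ σ)
    (hL : L = zM - zS) (hL0 : 0 ≤ L) (hM1 : (Real.sqrt (1 + e))⁻¹ * s ≤ zM) (hM2 : zM ≤ s)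
    (hS1 : (Real.sqrt (1 + e))⁻¹ * σ ≤ zS) (hS2 : zS ≤ σ) :
    ∃ c, 0 < c ∧ c * s = L + σ ∧ c ^ 2 ≤ 1 + e ∧ 1 ≤ (1 + e) * c ^ 2 := by
  have hq : 1 ≤ Real.sqrt (1 + e) := Real.one_le_sqrt.mpr (by linarith)
  have hq2 : Real.sqrt (1 + e) ^ 2 = 1 + e := Real.sq_sqrt (by linarith)
  set q := Real.sqrt (1 + e)
  have hq0 : 0 < q := by linarith
  rw [inv_mul_le_iff₀ hq0] at hM1 hS1
  -- `s ≤ q zM = q (L + zS) ≤ q (L + σ)`, and conversely `L + σ ≤ q L + q zS = q zM ≤ q s`: the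
  -- heights are the intermediary between the two lengths.
  have h1 : s ≤ q * (L + σ) := hM1.trans (mul_le_mul_of_nonneg_left (by linarith) hq0.le)
  have h2 : L + σ ≤ q * s := by
    have h3 : L ≤ q * L := le_mul_of_one_le_left hL0 hq
    have h4 : q * zM ≤ q * s := mul_le_mul_of_nonneg_left hM2 hq0.le
    have h5 : q * L = q * zM - q * zS := by rw [hL]; ring
    linarith
  -- If `s = 0`, the second inequality forces `L + σ = 0`, so `c` is free and `1` is taken.
  rcases hs.eq_or_lt with rfl | hs'
  · exact ⟨1, one_pos, by linarith, by linarith, by linarith⟩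
  · have h3 : 0 < L + σ := pos_of_mul_pos_right (hs'.trans_le h1) hq0.le
    have hc : 0 < (L + σ) / s := div_pos h3 hs'
    have h4 : (L + σ) / s ≤ q := (div_le_iff₀ hs').mpr h2
    have h5 : 1 ≤ q * ((L + σ) / s) := by
      rw [← mul_div_assoc, one_le_div₀ hs']
      exact h1
    refine ⟨(L + σ) / s, hc, div_mul_cancel₀ _ hs'.ne', ?_, ?_⟩
    · rw [← hq2]
      exact pow_le_pow_left₀ hc.le h4 2
    · rw [← hq2, ← mul_pow]
      exact one_le_pow₀ h5

theorem horizonRadius_le_appendedSchRadius {n : ℕ} {m : ℝ} (hn : 3 ≤ n) (hm : 0 < m) (L t : ℝ) :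
    horizonRadius n m ≤ appendedSchRadius n m L t := by
  rw [appendedSchRadius]
  split_ifs with h
  · exact le_rfl
  · exact horizonRadius_le_schRadius hn hm (by linarith)

theorem appendedSchRadius_le {n : ℕ} {m : ℝ} (hn : 3 ≤ n) (hm : 0 < m) {L t R : ℝ}
    (hR : horizonRadius n m ≤ R) (ht : t ≤ L + schDistance n m R) :
    appendedSchRadius n m L t ≤ R := by
  rw [appendedSchRadius]
  split_ifs with h
  · exact hR
  · have h0 : 0 ≤ t - L := by linarith
    have h1 : t - L ≤ schDistance n m R := by linarith
    have := (strictMonoOn_schRadius hn hm).monotoneOn h0 (h0.trans h1) h1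
    rwa [schRadius_schDistance hn hm hR] at this

theorem appendedSchRadius_add_schDistance {n : ℕ} {m : ℝ} (hn : 3 ≤ n) (hm : 0 < m) (L : ℝ) {R : ℝ}
    (hR : horizonRadius n m ≤ R) : appendedSchRadius n m L (L + schDistance n m R) = R := by
  rw [appendedSchRadius]
  have h0 : 0 ≤ schDistance n m R := (bijOn_schDistance hn hm).mapsTo hR
  split_ifs with h
  · have h1 : schDistance n m R = schDistance n m (horizonRadius n m) := by
      rw [schDistance_horizonRadius]
      linarith
    exact ((strictMonoOn_schDistance hn hm).injOn hR self_mem_Ici h1).symm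
  · rw [add_sub_cancel_left, schRadius_schDistance hn hm hR]

/-- The inner stretch costs only `1 + √δ`, which the middle entry `(1+√δ)(1+δ)` of the maximum
dominates. -/
theorem hDelta_bounds (n : ℕ) {δ : ℝ} (hδ0 : 0 ≤ δ) :
    (1 + Real.sqrt δ) ^ (2 / ((n : ℝ) - 2)) ≤ hDelta n δ ∧ 1 + Real.sqrt δ ≤ hDelta n δ ∧
      (1 - Real.sqrt δ)⁻¹ ≤ hDelta n δ := by
  have he := Real.sqrt_nonneg δ
  refine ⟨(le_max_left _ _).trans (le_max_left _ _), ?_, le_max_right _ _⟩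
  refine le_trans ?_ ((le_max_right _ _).trans (le_max_left _ _))
  exact le_mul_of_one_le_right (by linarith) (by linarith)

theorem sq_le_of_mem_Icc {a b x y h : ℝ} (ha : 0 < a) (hx : x ∈ Icc a b) (hy : y ∈ Icc a b)
    (h1 : (b / a) ^ 2 ≤ h) : x ^ 2 ≤ h * y ^ 2 := by
  have h2 : x ≤ b / a * y := by
    rw [div_mul_eq_mul_div, le_div_iff₀ ha]
    exact mul_le_mul hx.2 hy.1 ha.le (ha.le.trans (hx.1.trans hx.2))
  have h3 := pow_le_pow_left₀ (ha.le.trans hx.1) h2 2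
  rw [mul_pow] at h3
  exact h3.trans (mul_le_mul_of_nonneg_right h1 (sq_nonneg y))

/-- The right derivative of `schDistance ∘ r` at and beyond the sphere of radius `r_δ`. -/
theorem RadiusProfile.exists_right_deriv {n : ℕ} {m δ : ℝ} {r q : ℝ → ℝ} (hn : 3 ≤ n) (hm : 0 < m)
    (ha : horizonRadius n m = r 0) (h : RadiusProfile (n - 2) δ r q) (hδ : 0 ≤ δ) {s : ℝ}
    (hs : 0 ≤ s) (hr : (1 + Real.sqrt δ) * (2 * m) ≤ r s ^ (n - 2)) :
    ∃ D, HasDerivWithinAt (fun s => schDistance n m (r s)) D (Ici s) s ∧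
      1 - Real.sqrt δ ≤ D ^ 2 ∧ D ^ 2 ≤ 1 := by
  -- At `s = 0` the quotient `r'/√V` degenerates to `0/0`. The radius bound there forces `δ = 0`, so
  -- the derivative is identically `1` for `t > 0` and its limit is the right derivative at `0`.
  rcases hs.eq_or_lt with rfl | hs'
  · rw [← ha, horizonRadius_pow hn hm] at hr
    have he : Real.sqrt δ = 0 := by
      refine le_antisymm ?_ (Real.sqrt_nonneg δ)
      have : Real.sqrt δ * (2 * m) ≤ 0 := by linarith
      exact nonpos_of_mul_nonpos_left this (by linarith)
    have hd : ∀ t, 0 < t → HasDerivAt (fun s => schDistance n m (r s)) 1 t := by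
      intro t ht
      refine (hasDerivAt_schDistance_comp hn hm ha h ht).congr_deriv ?_
      have h1 := deriv_comp_sq_le hn hm ha h ht
      have h2 := le_deriv_comp_sq hn hm ha h hδ ht (by
        rw [he, add_zero, one_mul, ← horizonRadius_pow hn hm]
        exact pow_le_pow_left₀ (horizonRadius_pos hm).le (horizonRadius_le ha h ht.le) _)
      rw [he, sub_zero] at h2
      have h3 := deriv_comp_pos hn hm ha h ht
      exact (pow_eq_one_iff_of_nonneg h3.le two_ne_zero).mp (le_antisymm h1 h2)
    refine ⟨1, hasDerivWithinAt_Ici_of_tendsto_deriv (s := Ioi 0) (fun t ht =>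
      (hd t ht).differentiableAt.differentiableWithinAt) ?_ self_mem_nhdsWithin ?_, ?_, ?_⟩
    · exact ((continuousOn_schDistance_comp hn hm ha h) 0 self_mem_Ici).mono Ioi_subset_Ici_self
    · exact tendsto_const_nhds.congr'
        (eventually_nhdsWithin_of_forall fun t ht => (hd t ht).deriv.symm)
    · rw [he]; norm_num
    · norm_num
  · exact ⟨_, (hasDerivAt_schDistance_comp hn hm ha h hs').hasDerivWithinAt,
      le_deriv_comp_sq hn hm ha h hδ hs' hr, deriv_comp_sq_le hn hm ha h hs'⟩

end

end PenroseStability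

end

/-! ### Assembly of the comparison map. -/

open PenroseStability RadiusProfile in
theorem mainTheorem1 (n : ℕ) (hn : 3 ≤ n) (r : ℝ → ℝ) (hM : PenroseStability.RotSym n r)
    (δ : ℝ) (hδ0 : 0 ≤ δ) (hδ1 : δ < 1)
    (hmass : PenroseStability.HasADMMass n r
      ((1 + δ) / 2 * (PenroseStability.sphereArea n r 0 / PenroseStability.unitSphereArea n)
        ^ (((n : ℝ) - 2) / ((n : ℝ) - 1)))) :
    ∃ L : ℝ, PenroseStability.IsDepth n r δ L ∧
      (∀ L' : ℝ, PenroseStability.IsDepth n r δ L' → L' = L) ∧ 0 ≤ L ∧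
      ∃ φ : PenroseStability.E n → PenroseStability.E n,
        PenroseStability.IsBiLipschitz (PenroseStability.warpedMetric r)
          (PenroseStability.warpedMetric
            (PenroseStability.appendedSchRadius n (PenroseStability.boundaryMass n r) L)) φ ∧
        PenroseStability.IsRotEquivariant φ ∧
        (∀ s : ℝ, 0 ≤ s →
          PenroseStability.areaDelta n r δ ≤ PenroseStability.sphereArea n r s →
          ∃ σ : ℝ, 0 ≤ σ ∧
            φ '' PenroseStability.symSphere n s = PenroseStability.symSphere n σ ∧
            PenroseStability.sphereArea n
              (PenroseStability.appendedSchRadius n (PenroseStability.boundaryMass n r) L) σ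
              = PenroseStability.sphereArea n r s) ∧
        (∀ s : ℝ, 0 ≤ s →
          PenroseStability.sphereArea n r s ≠ PenroseStability.areaDelta n r δ →
          ∀ x ∈ PenroseStability.symSphere n s,
            DifferentiableWithinAt ℝ φ (PenroseStability.Ext n) x) ∧
        (∀ x ∈ PenroseStability.Ext n, ∀ v : PenroseStability.E n, v ≠ 0 →
          ∃ w : PenroseStability.E n, PenroseStability.IsPushforward φ x v w ∧
            (PenroseStability.hDelta n δ)⁻¹ ≤
              PenroseStability.warpedMetric r x v v /
                PenroseStability.warpedMetric
                  (PenroseStability.appendedSchRadius n (PenroseStability.boundaryMass n r) L)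
                  (φ x) w w ∧
            PenroseStability.warpedMetric r x v v /
                PenroseStability.warpedMetric
                  (PenroseStability.appendedSchRadius n (PenroseStability.boundaryMass n r) L)
                  (φ x) w w ≤ PenroseStability.hDelta n δ) := by
  have hP := hM.radiusProfile hn hmass
  have hm := hM.boundaryMass_pos hn
  have ha := hM.horizonRadius_boundaryMass hn
  have hr0 := hM.pos 0 le_rfl
  have h2m := hM.two_mul_boundaryMass hn
  have hω := unitSphereArea_pos hn
  set m := boundaryMass n r
  set R := radiusDelta n r δ with hRdef
  set e := Real.sqrt δ with hedef
  have he : 0 ≤ e := Real.sqrt_nonneg δ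
  have he1 : e < 1 := by
    rw [hedef, Real.sqrt_lt' one_pos, one_pow]
    exact hδ1
  have hRpow : R ^ (n - 2) = (1 + e) * (2 * m) := by rw [hRdef, radiusDelta_pow hn, h2m]
  have hR0 : r 0 ≤ R := le_radiusDelta hn hr0 δ
  have haR : horizonRadius n m ≤ R := ha.trans_le hR0
  obtain ⟨s₀, hs₀, hrs₀⟩ := hP.exists_eq hR0
  set σ₀ := schDistance n m R with hσdef
  have hσ₀ : 0 ≤ σ₀ := (bijOn_schDistance hn hm).mapsTo haR
  have hσR : schRadius n m σ₀ = R := schRadius_schDistance hn hm haR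
  set L := graphHeight r s₀ - graphHeight (schRadius n m) σ₀ with hL
  have hL0 : 0 ≤ L := by
    have := hP.height_comparison hn hm ha hs₀
    rw [hrs₀] at this
    exact sub_nonneg.mpr this
  obtain ⟨hM1, hM2⟩ := hP.graphHeight_bounds hn hm ha he hs₀ (by rw [hrs₀, hRpow])
  obtain ⟨hS1, hS2⟩ := graphHeight_schRadius_bounds hn hm he hσ₀ (by rw [hσR, hRpow])
  obtain ⟨c, hc0, hcs, hc1, hc2⟩ := exists_stretch he hs₀ hσ₀ hL hL0 hM1 hM2 hS1 hS2
  refine ⟨L, ⟨s₀, σ₀, hs₀, hσ₀, hrs₀, hσR, by rw [hL]; ring⟩, ?_, hL0, ?_⟩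
  -- Both radius functions are injective, so the radius `r_δ` determines `s` and `σ`, and with them
  -- the depth.
  · rintro L' ⟨s, σ, hs, hσ, hrs, hrσ, hL'⟩
    obtain rfl : s = s₀ := hP.strictMonoOn.injOn hs hs₀ (hrs.trans hrs₀.symm)
    obtain rfl : σ = σ₀ := (strictMonoOn_schRadius hn hm).injOn hσ hσ₀ (hrσ.trans hσR.symm)
    rw [hL]
    linarith
  obtain ⟨hh1, hh2, hh3⟩ := hDelta_bounds n hδ0
  rw [← radiusDelta_div_sq hr0] at hh1
  set h := hDelta n δ
  have hh0 : 0 < h := by linarith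
  have hDh : ∀ D : ℝ, 1 - e ≤ D ^ 2 → D ^ 2 ≤ 1 → D ^ 2 ≤ h ∧ 1 ≤ h * D ^ 2 := by
    intro D h1 h2
    refine ⟨by linarith, ?_⟩
    have h3 : 1 ≤ h * (1 - e) := (inv_le_iff_one_le_mul₀ (by linarith)).mp hh3
    exact h3.trans (mul_le_mul_of_nonneg_left h1 hh0.le)
  have hch : c ^ 2 ≤ h ∧ 1 ≤ h * c ^ 2 :=
    ⟨hc1.trans hh2, hc2.trans (mul_le_mul_of_nonneg_right hh2 (sq_nonneg c))⟩
  -- The distance from the boundary of the appended Schwarzschild space to its sphere of radius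
  -- `r(s)`; the choice of `c` is what makes it meet the linear piece at `s₀`.
  let g : ℝ → ℝ := fun s => L + schDistance n m (r s)
  have hg : g s₀ = c * s₀ := by
    show L + schDistance n m (r s₀) = c * s₀
    rw [hrs₀, hcs]
  have hge : ∀ s, s₀ ≤ s → (1 + e) * (2 * m) ≤ r s ^ (n - 2) := by
    intro s hs
    rw [← hRpow, ← hrs₀]
    exact pow_le_pow_left₀ (hP.pos' hs₀).le
      (hP.strictMonoOn.monotoneOn hs₀ (hs₀.trans hs) hs) _
  have hgd : ∀ s, 0 < s → HasDerivAt g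
      ((Real.sqrt (schPotential n m (r s)))⁻¹ * derivWithin r (Ici 0) s) s := fun s hs =>
    (hasDerivAt_schDistance_comp hn hm ha hP hs).const_add L
  have hgc : ContinuousOn g (Ici s₀) :=
    (continuousOn_const.add (continuousOn_schDistance_comp hn hm ha hP)).mono
      (Ici_subset_Ici.mpr hs₀)
  set ψ := glue s₀ c g with hψdef
  have hb : 0 < Real.sqrt (1 - e) := Real.sqrt_pos.mpr (by linarith)
  have hincr : ∀ s, 0 ≤ s → ∀ s', s ≤ s' →
      min c (Real.sqrt (1 - e)) * (s' - s) ≤ ψ s' - ψ s ∧ ψ s' - ψ s ≤ max c 1 * (s' - s) := by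
    intro s hs s' hss'
    refine glue_increment_bounds hg hs₀ hgc (fun t ht => hgd t (hs₀.trans_lt ht)) (min_le_left _ _)
      (le_max_left _ _) (fun t ht => (min_le_right _ _).trans ?_)
      (fun t ht => le_trans ?_ (le_max_right _ _)) hs hss'
    · have ht0 := hs₀.trans_lt ht
      exact Real.sqrt_le_iff.mpr ⟨(deriv_comp_pos hn hm ha hP ht0).le,
        le_deriv_comp_sq hn hm ha hP hδ0 ht0 (hge t ht.le)⟩
    · have ht0 := hs₀.trans_lt ht
      exact (sq_le_one_iff₀ (deriv_comp_pos hn hm ha hP ht0).le).mp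
        (deriv_comp_sq_le hn hm ha hP ht0)
  have hψ0 : ψ 0 = 0 := by rw [hψdef, glue_of_le hs₀, mul_zero]
  have hmin : 0 < min c (Real.sqrt (1 - e)) := lt_min hc0 hb
  obtain ⟨hbij, hup, hlow⟩ := bijOn_of_increment_bounds hmin hψ0 hincr
  set r' := appendedSchRadius n m L with hr'def
  have hr'eq : ∀ s, s₀ ≤ s → r' (ψ s) = r s := fun s hs => by
    rw [hψdef, glue_of_ge hg hs]
    exact appendedSchRadius_add_schDistance hn hm L (horizonRadius_le ha hP (hs₀.trans hs))
  -- Inside `s₀` the areas of corresponding spheres are not matched; it suffices that both radii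
  -- stay in `[r(0), R]`, since `ψ` maps `[0, s₀]` into `[0, L + σ₀]`.
  have hmem : ∀ s, 0 ≤ s → s ≤ s₀ → r s ∈ Icc (r 0) R ∧ r' (ψ s) ∈ Icc (r 0) R := by
    intro s hs hss₀
    refine ⟨⟨hP.zero_le hs, hrs₀ ▸ hP.strictMonoOn.monotoneOn hs hs₀ hss₀⟩,
      ha ▸ horizonRadius_le_appendedSchRadius hn hm L _, appendedSchRadius_le hn hm haR ?_⟩
    rw [hψdef, glue_of_le hss₀, ← hσdef, ← hcs]
    exact mul_le_mul_of_nonneg_left hss₀ hc0.le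
  have hr'pos : ∀ t, 0 < r' t := fun t =>
    (horizonRadius_pos hm).trans_le (horizonRadius_le_appendedSchRadius hn hm L t)
  have hratio : ∀ s, 0 ≤ s → r s ^ 2 ≤ (R / r 0) ^ 2 * r' (ψ s) ^ 2 ∧
      r' (ψ s) ^ 2 ≤ (R / r 0) ^ 2 * r s ^ 2 := by
    intro s hs
    rcases le_total s s₀ with hss₀ | hss₀
    · obtain ⟨h1, h2⟩ := hmem s hs hss₀
      exact ⟨sq_le_of_mem_Icc hr0 h1 h2 le_rfl, sq_le_of_mem_Icc hr0 h2 h1 le_rfl⟩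
    · rw [hr'eq s hss₀, and_self]
      exact le_mul_of_one_le_left (sq_nonneg _) (one_le_pow₀ ((one_le_div₀ hr0).mpr hR0))
  have harea : ∀ s, 0 ≤ s → sphereArea n r s = unitSphereArea n * r s ^ (n - 1) := fun _ _ => rfl
  refine ⟨radialMap ψ, ?_, isRotEquivariant_radialMap, ?_, ?_, ?_⟩
  · have hq0 : 0 ≤ R / r 0 := div_nonneg (hr0.le.trans hR0) hr0.le
    have hK1 : 0 < max c 1 := lt_max_of_lt_left hc0
    have hK2 := inv_pos.mpr hmin
    -- The sum majorizes at once the Lipschitz constants of `ψ` and of its inverse and the ratio of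
    -- the radii.
    set K : ℝ := max c 1 + (min c (Real.sqrt (1 - e)))⁻¹ + R / r 0
    have hK : 0 < K := by positivity
    refine isBiLipschitz_radialMap hbij (K := ⟨K, hK.le⟩) ?_ ?_ ?_ ?_ ?_
    · exact fun h0 => hK.ne' (congrArg NNReal.toReal h0)
    · intro s hs s' hs'
      refine (hup s hs s' hs').trans (mul_le_mul_of_nonneg_right ?_ (abs_nonneg _))
      show max c 1 ≤ K
      linarith
    · intro s hs s' hs'
      have h1 := hlow s hs s' hs'
      rw [← le_inv_mul_iff₀ hmin] at h1
      refine h1.trans (mul_le_mul_of_nonneg_right ?_ (abs_nonneg _))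
      show (min c (Real.sqrt (1 - e)))⁻¹ ≤ K
      linarith
    · intro s hs
      have h1 := sq_le_sq.mp ((hratio s hs).2.trans_eq (mul_pow _ _ _).symm)
      rw [abs_mul, abs_of_nonneg hq0] at h1
      refine h1.trans (mul_le_mul_of_nonneg_right ?_ (abs_nonneg _))
      show R / r 0 ≤ K
      linarith
    · intro s hs
      have h1 := sq_le_sq.mp ((hratio s hs).1.trans_eq (mul_pow _ _ _).symm)
      rw [abs_mul, abs_of_nonneg hq0] at h1
      refine h1.trans (mul_le_mul_of_nonneg_right ?_ (abs_nonneg _))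
      show R / r 0 ≤ K
      linarith
  · intro s hs hA
    have hss₀ : s₀ ≤ s := by
      rw [areaDelta_eq hn, harea s hs, mul_le_mul_iff_right₀ hω,
        pow_le_pow_iff_left₀ (hr0.le.trans hR0) (hP.pos' hs).le (by omega), ← hrs₀] at hA
      exact (hP.strictMonoOn.le_iff_le hs₀ hs).mp hA
    refine ⟨ψ s, hbij.mapsTo hs, image_radialMap_symSphere hbij.mapsTo hs, ?_⟩
    rw [sphereArea, sphereArea, hr'eq s hss₀]
  · intro s hs hA x hx
    have hx1 : ‖x‖ = 1 + s := by simpa [symSphere] using hx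
    have hx2 : ‖x‖ - 1 = s := by rw [hx1]; ring
    have hne : s ≠ s₀ := by
      rintro rfl
      exact hA (by rw [areaDelta_eq hn, harea s hs, hrs₀])
    refine differentiableWithinAt_radialMap (show 1 ≤ ‖x‖ by linarith) ?_
    rw [hx2]
    rcases hne.lt_or_gt with hlt | hgt
    · exact (hasDerivAt_glue_of_lt hlt).differentiableAt.differentiableWithinAt
    · exact (hasDerivAt_glue_of_gt hg hgt
        (hgd s (hs₀.trans_lt hgt))).differentiableAt.differentiableWithinAt
  · intro x hx v hv
    have hs := sub_one_nonneg hx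
    obtain ⟨hq1, hq2⟩ := hratio _ hs
    -- At the corner `s₀` the right derivative comes from the outer piece, and the left derivative
    -- `D'` below from the linear one; each satisfies the bounds.
    obtain ⟨D, hD, hD1, hD2⟩ : ∃ D, HasDerivWithinAt ψ D (Ici (‖x‖ - 1)) (‖x‖ - 1) ∧
        D ^ 2 ≤ h ∧ 1 ≤ h * D ^ 2 := by
      rcases lt_or_ge (‖x‖ - 1) s₀ with hlt | hle
      · exact ⟨c, (hasDerivAt_glue_of_lt hlt).hasDerivWithinAt, hch⟩
      · obtain ⟨D, hD, h1, h2⟩ := exists_right_deriv hn hm ha hP hδ0 hs (hge _ hle)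
        exact ⟨D, hasDerivWithinAt_glue_Ici hg hle (hD.const_add L), hDh D h1 h2⟩
    obtain ⟨D', hD'⟩ : ∃ D', 0 < ‖x‖ - 1 → HasDerivWithinAt ψ D' (Iic (‖x‖ - 1)) (‖x‖ - 1) ∧
        D' ^ 2 ≤ h ∧ 1 ≤ h * D' ^ 2 := by
      rcases le_or_gt (‖x‖ - 1) s₀ with hle | hgt
      · exact ⟨c, fun _ => ⟨hasDerivWithinAt_glue_Iic hle, hch⟩⟩
      · exact ⟨_, fun hpos => ⟨(hasDerivAt_glue_of_gt hg hgt (hgd _ hpos)).hasDerivWithinAt,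
          hDh _ (le_deriv_comp_sq hn hm ha hP hδ0 hpos (hge _ hgt.le))
            (deriv_comp_sq_le hn hm ha hP hpos)⟩⟩
    exact radialMap_pushforward_ratio hbij.mapsTo hx hv hh0 (hP.pos' hs)
      (hq1.trans (mul_le_mul_of_nonneg_right hh1 (sq_nonneg _)))
      (hq2.trans (mul_le_mul_of_nonneg_right hh1 (sq_nonneg _))) hD hD1 hD2 hD'
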